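/- **Setting.** Let $p\ge 1$ and let $P_\ell$ be the Legendre polynomials. On a probability space, let $Z=\{Z(x,t)\}$ be a Gaussian spherical white noise on $\mathbb S^2\times\mathbb Z$: the (jointly measurable) fields $Z(\cdot,t)$, $t\in\mathbb Z$, are i.i.d., Gaussian, centered and isotropic, with covariance $\Gamma_Z(x,y)=\mathbb E[Z(x,t)Z(y,t)]=\sum_{\ell\ge0}\frac{2\ell+1}{4\pi}C_{\ell;Z}P_\ell(\langle x,y\rangle)$ and $\sum_{\ell}\frac{2\ell+1}{4\pi}C_{\ell;Z}<\infty$. Let $T=\{T(x,t)\}$ be a real, centered, mean-square continuous, (measurable) Gaussian random field on $\mathbb S^2\times\mathbb Z$, isotropic in space and stationary in time, i.e. $T(R\,\cdot,\cdot+\tau)\overset{d}{=}T(\cdot,\cdot)$ for $R\in SO(3)$, $\tau\in\mathbb Z$, which solves the SPHAR($p$) equation $$T(x,t)=\sum_{j=1}^p\int_{\mathbb S^2}k_j(\langle x,y\rangle)\,T(y,t-j)\,dy+Z(x,t)\quad\text{a.s., for every }(x,t),$$ with continuous kernels $k_j:[-1,1]\to\mathbb R$. Put $\phi_{\ell;j}=2\pi\int_{-1}^1k_j(z)P_\ell(z)\,dz$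 (so that $k_j=\sum_\ell\phi_{\ell;j}\frac{2\ell+1}{4\pi}P_\ell$), $\phi_\ell(z)=1-\sum_{j=1}^p\phi_{\ell;j}z^j$, $$\mu_{\min;\ell}=\min_{|z|=1}|\phi_\ell(z)|^2,\qquad \mu_{\max;\ell}=\max_{|z|=1}|\phi_\ell(z)|^2,\qquad q_\ell=\#\{j:\phi_{\ell;j}\neq0\}.$$ With the real orthonormal spherical harmonics $Y_{\ell,m}$, $-\ell\le m\le \ell$, let $a_{\ell,m}(t)=\int_{\mathbb S^2}T(x,t)Y_{\ell,m}(x)\,dx$. For $N\ge1$ and $n=N+p$ let $X_{\ell,N}$ be the $N(2\ell+1)\times p$ matrix whose row indexed by $(m,t)$, $-\ell\le m\le\ell$, $p+1\le t\le n$, is $(a_{\ell,m}(t-1),\dots,a_{\ell,m}(t-p))$, and let $\widehat\Gamma_{\ell,N}=X_{\ell,N}'X_{\ell,N}/(N(2\ell+1))$. A symmetric $p\times p$ matrix $A$ satisfies the restricted eigenvalue condition $RE(\alpha,\tau)$, with curvature $\alpha>0$ and tolerance $\tau\ge0$, if $\theta'A\theta\ge\alpha\|\theta\|_2^2-\tau\|\theta\|_1^2$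 for all $\theta\in\mathbb R^p$. Assume (Identifiability) $\int_{\mathbb S^2\times\mathbb S^2}\Gamma_Z(x,y)f(x)f(y)\,dx\,dy>0$ for every non-zero $f\in L^2(\mathbb S^2)$, and (Stationarity) $\phi_\ell(z)\ne0$ for all $|z|\le1$ and all $\ell\ge0$. **Proposition (Compatibility condition).** For every $b>0$ there exist constants $c_1,c_2,c>0$, depending on $b$ only (in particular not on $p$, $L_N$, $N$ or the model), such that the following holds for every model as above and all integers $L_N,N\ge1$. Put $q_N=\max_{\ell<L_N}q_\ell$, $c_3=c\,p$ and $$\omega_N=c_3\max_{\ell<L_N}\frac{\mu_{\max;\ell}}{\mu_{\min;\ell}}.$$ If $N\ge b\,\max\{\omega_N^2,1\}\,q_N\log(pL_N)$, then $$\mathbb P\Big(\bigcap_{\ell=0}^{L_N-1}\{\widehat\Gamma_{\ell,N}\sim RE(\alpha_\ell,\tau_\ell)\}\Big)\ge1-c_1e^{-c_2N\min\{\omega_N^{-2},1\}},$$ with $$\alpha_\ell=\frac{C_{\ell;Z}}{2\mu_{\max;\ell}},\qquad\tau_\ell=\alpha_\ell\max\{\omega_N^2,1\}\frac{\log(pL_N)}{N}.$$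 -/

import Mathlib

open MeasureTheory ProbabilityTheory Topology
open scoped BigOperators Matrix

noncomputable section

namespace Sphar

/-- Euclidean three-space. -/
abbrev E3 : Type := EuclideanSpace ℝ (Fin 3)

/-- The unit sphere in `ℝ³`. -/
abbrev S2 : Type := Metric.sphere (0 : E3) 1

/-- The spherical Lebesgue measure `dx = sin θ dθ dφ`, of total mass `4π`. -/
def sphereMeasure : Measure S2 := (volume : Measure E3).toSphere

/-- The action on the sphere of a linear isometry of `ℝ³`. -/
def rotate (R : E3 ≃ₗᵢ[ℝ] E3) (x : S2) : S2 :=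
  ⟨R x, by simp⟩

/-- Membership of a linear isometry of `ℝ³` in `SO(3)`. -/
def IsRotation (R : E3 ≃ₗᵢ[ℝ] E3) : Prop :=
  LinearMap.det (R.toLinearEquiv : E3 →ₗ[ℝ] E3) = 1

/-- The Legendre polynomial `P_ℓ(u) = (1 / (2^ℓ ℓ!)) d^ℓ/du^ℓ (u² - 1)^ℓ`. -/
def legendreP (ℓ : ℕ) : Polynomial ℝ :=
  Polynomial.C (1 / (2 ^ ℓ * (ℓ.factorial : ℝ))) *
    Polynomial.derivative^[ℓ] ((Polynomial.X ^ 2 - 1) ^ ℓ)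

/-- The real spherical harmonic `Y_{ℓ,m}`, for `-ℓ ≤ m ≤ ℓ`, written in Cartesian coordinates.
For a point with colatitude `θ` and longitude `φ` one has `x₂ = cos θ` and
`x₀ + i x₁ = sin θ e^{iφ}`. Hence, with the associated Legendre function
`P_{ℓ,k}(u) = (1 - u²)^{k/2} (d/du)^k P_ℓ(u)`, the real and the imaginary part of
`(x₀ + i x₁)^k` times `P_ℓ^{(k)}(x₂)` are `P_{ℓ,k}(cos θ) cos (k φ)` and
`P_{ℓ,k}(cos θ) sin (k φ)`. -/
def sphHarm (ℓ : ℕ) (m : ℤ) (x : S2) : ℝ :=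
  let P : ℝ := (Polynomial.derivative^[m.natAbs] (legendreP ℓ)).eval ((x : E3) 2)
  let w : ℂ := (⟨(x : E3) 0, (x : E3) 1⟩ : ℂ) ^ m.natAbs
  let r : ℝ := ((ℓ - m.natAbs).factorial : ℝ) / ((ℓ + m.natAbs).factorial : ℝ)
  if m = 0 then
    Real.sqrt ((2 * ℓ + 1) / (4 * Real.pi)) * P
  else if 0 < m then
    Real.sqrt ((2 * ℓ + 1) / (2 * Real.pi) * r) * P * w.re
  else
    Real.sqrt ((2 * ℓ + 1) / (2 * Real.pi) * r) * P * w.im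

/-- The index set `{-ℓ, …, ℓ}`. -/
abbrev Azimuth (ℓ : ℕ) : Type := Finset.Icc (-(ℓ : ℤ)) (ℓ : ℤ)

/-- The isotropic integral operator with kernel `k(⟨x, y⟩)`. -/
def kernelOp (k : ℝ → ℝ) (f : S2 → ℝ) (x : S2) : ℝ :=
  ∫ y, k (inner ℝ (x : E3) (y : E3)) * f y ∂sphereMeasure

/-- The coefficients `φ_ℓ = 2π ∫_{-1}^{1} k(z) P_ℓ(z) dz` of the expansion
`k(z) = ∑_ℓ φ_ℓ (2ℓ+1)/(4π) P_ℓ(z)`. -/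
def legendreCoeff (k : ℝ → ℝ) (ℓ : ℕ) : ℝ :=
  2 * Real.pi * ∫ z in (-1 : ℝ)..1, k z * (legendreP ℓ).eval z

/-- The vector `(φ_{ℓ;1}, …, φ_{ℓ;p})` of the autoregressive coefficients at multipole `ℓ`.
Entry `j : Fin p` belongs to lag `j + 1`. -/
def arCoeff {p : ℕ} (k : Fin p → ℝ → ℝ) (ℓ : ℕ) (j : Fin p) : ℝ :=
  legendreCoeff (k j) ℓ

/-- The polynomial `φ_ℓ(z) = 1 - φ_{ℓ;1} z - ⋯ - φ_{ℓ;p} z^p`. -/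
def arPoly {p : ℕ} (k : Fin p → ℝ → ℝ) (ℓ : ℕ) (z : ℂ) : ℂ :=
  1 - ∑ j : Fin p, (arCoeff k ℓ j : ℂ) * z ^ ((j : ℕ) + 1)

/-- `μ_{min;ℓ}`, the minimum of `|φ_ℓ|²` over the unit circle. -/
def muMin {p : ℕ} (k : Fin p → ℝ → ℝ) (ℓ : ℕ) : ℝ :=
  ⨅ z : Circle, ‖arPoly k ℓ (z : ℂ)‖ ^ 2

/-- `μ_{max;ℓ}`, the maximum of `|φ_ℓ|²` over the unit circle. -/
def muMax {p : ℕ} (k : Fin p → ℝ → ℝ) (ℓ : ℕ) : ℝ :=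
  ⨆ z : Circle, ‖arPoly k ℓ (z : ℂ)‖ ^ 2

/-- The sparsity index `q_ℓ`, the number of non-zero entries of `(φ_{ℓ;1}, …, φ_{ℓ;p})`. -/
def sparsity {p : ℕ} (k : Fin p → ℝ → ℝ) (ℓ : ℕ) : ℕ :=
  Set.ncard {j : Fin p | arCoeff k ℓ j ≠ 0}

/-- `q_N`, the maximum of `q_ℓ` over `ℓ < L`. -/
def maxSparsity {p : ℕ} (k : Fin p → ℝ → ℝ) (L : ℕ) : ℕ :=
  (Finset.range L).sup (sparsity k)

/-- `ω_N = c₃ max_{ℓ < L} μ_{max;ℓ} / μ_{min;ℓ}`. -/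
def omegaN {p : ℕ} (c₃ : ℝ) (k : Fin p → ℝ → ℝ) (L : ℕ) : ℝ :=
  c₃ * ⨆ ℓ : Fin L, muMax k ℓ / muMin k ℓ

variable {Ω : Type*} [MeasurableSpace Ω]

/-- `Z` is a Gaussian spherical white noise with angular power spectrum `C`: the fields `Z(·,t)`
are independent and identically distributed, Gaussian, centered and isotropic, with covariance
function `Γ_Z(x,y) = ∑_ℓ (2ℓ+1)/(4π) C_ℓ P_ℓ(⟨x,y⟩)`, where `∑_ℓ (2ℓ+1)/(4π) C_ℓ < ∞`. -/
structure IsWhiteNoise (μ : Measure Ω) (Z : S2 → ℤ → Ω → ℝ) (C : ℕ → ℝ) : Prop where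
  measurable : ∀ t, Measurable fun q : S2 × Ω => Z q.1 t q.2
  gaussian : ∀ t, IsGaussianProcess (fun x => Z x t) μ
  centered : ∀ x t, ∫ ω, Z x t ω ∂μ = 0
  isotropic : ∀ (R : E3 ≃ₗᵢ[ℝ] E3), IsRotation R → ∀ t,
    IdentDistrib (fun ω (x : S2) => Z (rotate R x) t ω) (fun ω (x : S2) => Z x t ω) μ μ
  indep : iIndepFun (fun (t : ℤ) ω (x : S2) => Z x t ω) μ
  identDistrib : ∀ t s,
    IdentDistrib (fun ω (x : S2) => Z x t ω) (fun ω (x : S2) => Z x s ω) μ μ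
  summable : Summable fun ℓ : ℕ => (2 * ℓ + 1) / (4 * Real.pi) * C ℓ
  covariance : ∀ (t : ℤ) (x y : S2),
    HasSum (fun ℓ : ℕ => (2 * ℓ + 1) / (4 * Real.pi) * C ℓ *
        (legendreP ℓ).eval (inner ℝ (x : E3) (y : E3)))
      (∫ ω, Z x t ω * Z y t ω ∂μ)

/-- `T` is a centered, mean-square continuous, Gaussian field on `S² × ℤ`, isotropic in space and
stationary in time, and solves `T(x,t) = ∑_{j=1}^p (Φ_j T(·,t-j))(x) + Z(x,t)`, where `Φ_j` is the
integral operator with the continuous isotropic kernel `k_j`. -/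
structure IsSPHAR {p : ℕ} (μ : Measure Ω) (k : Fin p → ℝ → ℝ) (T Z : S2 → ℤ → Ω → ℝ) :
    Prop where
  kernel_continuous : ∀ j, ContinuousOn (k j) (Set.Icc (-1) 1)
  measurable : ∀ t, Measurable fun q : S2 × Ω => T q.1 t q.2
  gaussian : IsGaussianProcess (fun q : S2 × ℤ => T q.1 q.2) μ
  centered : ∀ x t, ∫ ω, T x t ω ∂μ = 0
  mean_square_continuous : ∀ x t,
    Filter.Tendsto (fun y => ∫ ω, (T y t ω - T x t ω) ^ 2 ∂μ) (𝓝 x) (𝓝 0)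
  isotropic_stationary : ∀ (R : E3 ≃ₗᵢ[ℝ] E3), IsRotation R → ∀ τ : ℤ,
    IdentDistrib (fun ω (q : S2 × ℤ) => T (rotate R q.1) (q.2 + τ) ω)
      (fun ω (q : S2 × ℤ) => T q.1 q.2 ω) μ μ
  equation : ∀ x t, ∀ᵐ ω ∂μ,
    T x t ω =
      ∑ j : Fin p, kernelOp (k j) (fun y => T y (t - ((j : ℕ) + 1 : ℤ)) ω) x + Z x t ω

/-- Identifiability: `∫ Γ_Z(x,y) f(x) f(y) dx dy > 0` for every non-zero `f` in `L²(S²)`, where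
`Γ_Z(x,y) = E[Z(x,t) Z(y,t)]`. -/
def Identifiability (μ : Measure Ω) (Z : S2 → ℤ → Ω → ℝ) : Prop :=
  ∀ (t : ℤ) (f : S2 → ℝ), MemLp f 2 sphereMeasure → ¬ f =ᵐ[sphereMeasure] 0 →
    0 < ∫ q : S2 × S2, (∫ ω, Z q.1 t ω * Z q.2 t ω ∂μ) * f q.1 * f q.2
      ∂(sphereMeasure.prod sphereMeasure)

/-- Stationarity: `|z| ≤ 1` implies `φ_ℓ(z) ≠ 0`, for every `ℓ`. -/
def StationarityCondition {p : ℕ} (k : Fin p → ℝ → ℝ) : Prop :=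
  ∀ (ℓ : ℕ) (z : ℂ), ‖z‖ ≤ 1 → arPoly k ℓ z ≠ 0

/-- The harmonic coefficients `a_{ℓ,m}(t) = ∫ T(x,t) Y_{ℓ,m}(x) dx`. -/
def harmCoeff (T : S2 → ℤ → Ω → ℝ) (ℓ : ℕ) (m : ℤ) (t : ℤ) (ω : Ω) : ℝ :=
  ∫ x, T x t ω * sphHarm ℓ m x ∂sphereMeasure

/-- The `N(2ℓ+1) × p` data matrix `X_{ℓ,N}`, built from the observation times `1, …, n` with
`n = N + p`. The row `(m, i)` belongs to the time `t = p + 1 + i` in `{p + 1, …, n}`, the column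
`j` to lag `j + 1`; the entry is `a_{ℓ,m}(t - (j + 1))`. -/
def dataMatrix (T : S2 → ℤ → Ω → ℝ) (p N ℓ : ℕ) (ω : Ω) :
    Matrix (Azimuth ℓ × Fin N) (Fin p) ℝ :=
  Matrix.of fun r j =>
    harmCoeff T ℓ (r.1 : ℤ) (((p : ℤ) + 1 + (r.2 : ℕ)) - ((j : ℕ) + 1 : ℤ)) ω

/-- The estimator `X'X / (N(2ℓ+1))` of the covariance matrix `Γ_ℓ`. -/
def gammaHat (T : S2 → ℤ → Ω → ℝ) (p N ℓ : ℕ) (ω : Ω) : Matrix (Fin p) (Fin p) ℝ :=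
  (1 / ((N : ℝ) * (2 * ℓ + 1))) • ((dataMatrix T p N ℓ ω)ᵀ * dataMatrix T p N ℓ ω)

/-- The compatibility (restricted eigenvalue) condition `A ∼ RE(α, τ)` for a symmetric matrix:
`θ'Aθ ≥ α ‖θ‖₂² - τ ‖θ‖₁²` for all `θ`, with curvature `α > 0` and tolerance `τ ≥ 0`. -/
def SatisfiesRE {d : ℕ} (A : Matrix (Fin d) (Fin d) ℝ) (α τ : ℝ) : Prop :=
  A.IsSymm ∧ 0 < α ∧ 0 ≤ τ ∧
    ∀ θ : Fin d → ℝ, α * ∑ i, θ i ^ 2 - τ * (∑ i, |θ i|) ^ 2 ≤ θ ⬝ᵥ A *ᵥ θ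

/-- The curvature `α_ℓ = C_{ℓ;Z} / (2 μ_{max;ℓ})`. -/
def curvature {p : ℕ} (k : Fin p → ℝ → ℝ) (C : ℕ → ℝ) (ℓ : ℕ) : ℝ :=
  C ℓ / (2 * muMax k ℓ)

/-- The tolerance `τ_ℓ = α_ℓ max{ω², 1} log(pL) / N`. -/
def tolerance {p : ℕ} (k : Fin p → ℝ → ℝ) (C : ℕ → ℝ) (ω : ℝ) (L N ℓ : ℕ) : ℝ :=
  curvature k C ℓ * max (ω ^ 2) 1 * (Real.log ((p : ℝ) * L) / N)

end Sphar

end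

/-!
Write `a_{ℓ,m}` and `z_{ℓ,m}` for the harmonic coefficients of `T` and `Z`. The proof has three
ingredients.

*Reduction to scalar autoregressions.* By the Funk–Hecke formula the convolution with `k_j`
multiplies the coefficients of degree `ℓ` by `φ_{ℓ;j}`, so that almost surely
`a_{ℓ,m}(t) = ∑ φ_{ℓ;j} a_{ℓ,m}(t - j) + z_{ℓ,m}(t)` (`IsSPHAR.harmCoeff_eq`).
Funk–Hecke is proved from moments: `∫ ⟨a, x⟩^{2n} dx` is a multiple of `(∑ aᵢ²)^n`, first for real `a` by rotation
invariance and then for complex `a` as an identity between polynomials. Spherical harmonics appear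
as the coefficients in `s` of `⟨ξ(s), x⟩^ℓ` for a curve `ξ(s)` of isotropic vectors of `ℂ³`
(`assocHarm_eq`), so that the eigenvalues of the kernels `⟨x, y⟩^n`, the normalization of `Y_{ℓ,m}`
and the orthogonality of the Legendre polynomials are read off from these moments. Continuous
kernels follow by Weierstrass approximation (`integral_kernel_mul_sphHarm`).

*The noise.* `z_{ℓ,m}(t)` lies in the closed linear span of the Gaussian variables `Z(x, t)`,
because by Fubini's theorem everything orthogonal to all `Z(x, t)` is orthogonal to it. Hence it is
Gaussian and a function of the field at time `t` (`IsBoundedL2.gaussian_integral`), and `z_{ℓ,m} / √C_ℓ` is a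
sequence of independent standard Gaussian variables (`IsWhiteNoise.exists_isStdGaussianSeq`), where
`C_ℓ > 0` by identifiability.

*Deconvolution.* Put `y(t) = ∑ θ_j a(t - j)` and `w(t) = ∑ θ_j z(t - j)`, so that `y` filtered by
`φ_ℓ` is `w`. Cutting `y` off outside the observation window changes the filtered sequence only at
the first `p` times and beyond the end of the window, so that Parseval's identity gives
`∑ w(t)² ≤ μ_max ∑ y(t)²` (`sum_sq_forcing_le`). Thus `θ' Γ̂ θ` is bounded below through the
empirical autocovariance matrix of the noise alone, and neither the covariance of `T` nor `μ_min`
enters. That matrix is entrywise close to `C_ℓ` times the identity by Chernoff bounds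
(`IsStdGaussianSeq.measure_sum_sq_le`, `IsStdGaussianSeq.measure_abs_sum_mul_ge`); a relative
error `1 / (4p)` per entry suffices.

The theorem holds with `c = 32`, `c₁ = 4` and `c₂ = 1`, for which `ω_N ≥ 32 p`. If `N ≤ ω_N²`, the
probability bound is negative. If `N ≤ ω_N² log (pL)`, then `τ_ℓ ≥ α_ℓ`, and the inequality is
trivial as `‖θ‖₂ ≤ ‖θ‖₁`. Otherwise the union bound over the `(pL)² ≤ exp (2N / ω_N²)` entries, each
failing with probability at most `4 exp (-3N / ω_N²)`, gives the claim even with tolerance zero.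
-/

noncomputable section

open scoped Pointwise Polynomial

namespace Sphar

/-! ### Moments of linear forms over the sphere -/

instance : IsFiniteMeasure sphereMeasure := by unfold sphereMeasure; infer_instance

theorem measurePreserving_rotate (R : E3 ≃ₗᵢ[ℝ] E3) :
    MeasurePreserving (rotate R) sphereMeasure sphereMeasure := by
  have hm : Measurable (rotate R) := by
    have : Continuous (rotate R) := by unfold rotate; fun_prop
    exact this.measurable
  refine ⟨hm, ?_⟩
  ext s hs
  rw [Measure.map_apply hm hs, sphereMeasure, Measure.toSphere_apply' _ (hm hs),
    Measure.toSphere_apply' _ hs]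
  congr 1
  have : Set.Ioo (0:ℝ) 1 • (Subtype.val '' (rotate R ⁻¹' s) : Set E3)
      = R ⁻¹' (Set.Ioo (0:ℝ) 1 • (Subtype.val '' s : Set E3)) := by
    ext x
    simp only [Set.mem_smul, Set.mem_image, Set.mem_preimage]
    constructor
    · rintro ⟨r, hr, _, ⟨y, hy, rfl⟩, rfl⟩
      exact ⟨r, hr, R y, ⟨_, hy, rfl⟩, by simp⟩
    · rintro ⟨r, hr, _, ⟨y, hy, rfl⟩, h⟩
      refine ⟨r, hr, R.symm y, ⟨rotate R.symm y, ?_, rfl⟩, ?_⟩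
      · simpa [rotate] using hy
      · apply R.injective; simp [← h]
  rw [this, R.measurePreserving.measure_preimage_emb R.toHomeomorph.measurableEmbedding]

theorem integral_rotate {F : Type*} [NormedAddCommGroup F] [NormedSpace ℝ F]
    (R : E3 ≃ₗᵢ[ℝ] E3) (f : S2 → F) :
    ∫ x, f (rotate R x) ∂sphereMeasure = ∫ x, f x ∂sphereMeasure := by
  have hh : MeasurableEmbedding (rotate R) := by
    refine (MeasurableEquiv.mk ⟨rotate R, rotate R.symm, ?_, ?_⟩
      (measurePreserving_rotate R).measurable
      (measurePreserving_rotate R.symm).measurable).measurableEmbedding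
    · intro x; simp [rotate]
    · intro x; simp [rotate]
  exact (measurePreserving_rotate R).integral_comp hh f

/-- The complex bilinear form `∑ aᵢ xᵢ` in a complex vector `a` and a point of the sphere. -/
def lin (a : Fin 3 → ℂ) (x : S2) : ℂ := ∑ i, a i * ((x : E3) i : ℂ)

theorem continuous_lin (a : Fin 3 → ℂ) : Continuous (lin a) := by
  unfold lin; fun_prop

theorem integrable_of_continuous {F : Type*} [NormedAddCommGroup F]
    {f : S2 → F} (hf : Continuous f) : Integrable f sphereMeasure := by
  have := hf.continuousOn.integrableOn_compact (μ := sphereMeasure) (K := Set.univ) isCompact_univ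
  simpa using this

theorem sphereMeasure_univ : sphereMeasure.real Set.univ = 4 * Real.pi := by
  unfold sphereMeasure
  rw [Measure.toSphere_real_apply_univ]
  simp [Measure.real, EuclideanSpace.volume_ball_fin_three]
  have := Real.pi_pos
  rw [ENNReal.toReal_ofReal (by positivity)]
  ring

theorem eq_of_eval_ofReal_eq {p q : ℂ[X]} (h : ∀ t : ℝ, p.eval (t : ℂ) = q.eval (t : ℂ)) :
    p = q := by
  refine Polynomial.eq_of_infinite_eval_eq p q ?_
  refine (Set.infinite_range_of_injective Complex.ofReal_injective).mono ?_
  rintro _ ⟨t, rfl⟩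
  exact h t

/-- The polynomial in `t` whose value is `∫ (f + t g) ^ N`. -/
def powIntegral (f g : S2 → ℂ) (N : ℕ) : ℂ[X] :=
  ∑ j ∈ Finset.range (N + 1),
    Polynomial.monomial j ((N.choose j : ℂ) * ∫ x, f x ^ (N - j) * g x ^ j ∂sphereMeasure)

theorem eval_powIntegral {f g : S2 → ℂ} (hf : Continuous f) (hg : Continuous g) (N : ℕ) (t : ℂ) :
    (powIntegral f g N).eval t = ∫ x, (f x + t * g x) ^ N ∂sphereMeasure := by
  have h : ∀ x, (f x + t * g x) ^ N = ∑ j ∈ Finset.range (N + 1),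
      ((N.choose j : ℂ) * t ^ j) * (f x ^ (N - j) * g x ^ j) := by
    intro x
    rw [add_comm, add_pow]
    refine Finset.sum_congr rfl fun j _ => ?_
    rw [mul_pow]; ring
  simp_rw [h]
  rw [integral_finsetSum _ fun j _ => (integrable_of_continuous (by fun_prop)).const_mul _]
  simp_rw [integral_const_mul, powIntegral, Polynomial.eval_finsetSum, Polynomial.eval_monomial]
  refine Finset.sum_congr rfl fun j _ => ?_
  ring

theorem coeff_powIntegral (f g : S2 → ℂ) {N j : ℕ} (hj : j ≤ N) :
    (powIntegral f g N).coeff j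
      = (N.choose j : ℂ) * ∫ x, f x ^ (N - j) * g x ^ j ∂sphereMeasure := by
  simp only [powIntegral, Polynomial.finsetSum_coeff, Polynomial.coeff_monomial]
  rw [Finset.sum_ite_eq' (Finset.range (N + 1)) j]
  simp [Nat.lt_succ_of_le hj]

theorem lin_add_smul (a b : Fin 3 → ℂ) (t : ℂ) (x : S2) :
    lin (a + t • b) x = lin a x + t * lin b x := by
  simp only [lin, Finset.mul_sum, ← Finset.sum_add_distrib]
  refine Finset.sum_congr rfl fun i _ => ?_
  simp; ring

theorem lin_ofReal (v : E3) (x : S2) :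
    lin (fun i => (v i : ℂ)) x = ((inner ℝ (x : E3) v : ℝ) : ℂ) := by
  simp [lin, PiLp.inner_apply]

/-- Rotation invariance: the moments of a real linear form depend on its norm only. -/
theorem integral_lin_pow_ofReal (v : E3) (N : ℕ) :
    ∫ x, lin (fun i => (v i : ℂ)) x ^ N ∂sphereMeasure
      = (‖v‖ : ℂ) ^ N * ∫ x : S2, (((x : E3) 2 : ℝ) : ℂ) ^ N ∂sphereMeasure := by
  set e : E3 := EuclideanSpace.single 2 1 with he
  have hv : ‖v‖ = ‖‖v‖ • e‖ := by simp [he, norm_smul]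
  obtain ⟨R, hR⟩ : ∃ R : E3 ≃ₗᵢ[ℝ] E3, R v = ‖v‖ • e :=
    ⟨_, Submodule.reflection_sub hv⟩
  rw [← integral_const_mul, ← integral_rotate R.symm]
  refine integral_congr_ae (.of_forall fun x => ?_)
  have h : inner ℝ (R.symm (x : E3)) v = ‖v‖ * (x : E3) 2 := by
    rw [← R.inner_map_map, LinearIsometryEquiv.apply_symm_apply, hR, real_inner_smul_right, he,
      EuclideanSpace.inner_single_right]
    simp
  simp only [lin_ofReal, rotate]
  rw [h]; push_cast; ring

/-- The moments `∫ x₂ ^ N` of a coordinate. -/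
def coordMoment (N : ℕ) : ℂ := ∫ x : S2, (((x : E3) 2 : ℝ) : ℂ) ^ N ∂sphereMeasure

theorem coordMoment_odd {N : ℕ} (hN : Odd N) : coordMoment N = 0 := by
  have h := integral_rotate (LinearIsometryEquiv.neg ℝ)
    (fun x : S2 => (((x : E3) 2 : ℝ) : ℂ) ^ N)
  have h2 : ∀ x : S2, (((rotate (LinearIsometryEquiv.neg ℝ) x : S2) : E3) 2 : ℝ)
      = - (x : E3) 2 := fun x => by simp [rotate]
  simp only [h2, Complex.ofReal_neg, hN.neg_pow, integral_neg] at h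
  exact self_eq_neg.1 h.symm

theorem sum_sq_coord (x : S2) : (x : E3) 0 ^ 2 + (x : E3) 1 ^ 2 + (x : E3) 2 ^ 2 = 1 := by
  have h : ‖(x : E3)‖ = 1 := by simp
  have := EuclideanSpace.real_norm_sq_eq (x : E3)
  rw [h, Fin.sum_univ_three] at this
  linarith

/-- Comparison of the coefficients of `t²` in `∫ (x₂ + t xᵢ)^{2n+2} dx`, which is a multiple of
`(1 + t²)^{n+1}`. -/
theorem integral_sq_mul_pow (i : Fin 3) (hi : i ≠ 2) (n : ℕ) :
    ((2 * n + 2).choose 2 : ℂ) *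
      ∫ x : S2, (((x : E3) 2 : ℝ) : ℂ) ^ (2 * n) * (((x : E3) i : ℝ) : ℂ) ^ 2 ∂sphereMeasure
      = (n + 1) * coordMoment (2 * n + 2) := by
  have key : powIntegral (fun x => (((x : E3) 2 : ℝ) : ℂ)) (fun x => (((x : E3) i : ℝ) : ℂ))
      (2 * n + 2) = Polynomial.C (coordMoment (2 * n + 2)) * (1 + Polynomial.X ^ 2) ^ (n + 1) := by
    refine eq_of_eval_ofReal_eq fun t => ?_
    rw [eval_powIntegral (by fun_prop) (by fun_prop)]
    have h := integral_lin_pow_ofReal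
      (EuclideanSpace.single 2 1 + t • EuclideanSpace.single i 1) (2 * n + 2)
    have hn : ‖(EuclideanSpace.single 2 1 + t • EuclideanSpace.single i 1 : E3)‖ ^ 2
        = 1 + t ^ 2 := by
      rw [EuclideanSpace.real_norm_sq_eq, Fin.sum_univ_three]
      fin_cases i <;> simp at hi ⊢
      all_goals exact add_comm _ _
    have hl : ∀ x : S2, lin (fun j => (((EuclideanSpace.single 2 1 + t • EuclideanSpace.single i 1
        : E3) j : ℝ) : ℂ)) x = (((x : E3) 2 : ℝ) : ℂ) + t * (((x : E3) i : ℝ) : ℂ) := by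
      intro x
      simp only [lin, Fin.sum_univ_three]
      fin_cases i <;> simp at hi ⊢ <;> ring
    simp_rw [hl] at h
    rw [h, show 2 * n + 2 = 2 * (n + 1) by ring, pow_mul, ← Complex.ofReal_pow, hn]
    simp [coordMoment]
    ring
  have h2 := coeff_powIntegral (fun x => (((x : E3) 2 : ℝ) : ℂ)) (fun x => (((x : E3) i : ℝ) : ℂ))
    (N := 2 * n + 2) (j := 2) (by omega)
  rw [key, show 2 * n + 2 - 2 = 2 * n by omega] at h2
  rw [← h2, Polynomial.coeff_C_mul, add_comm (1 : ℂ[X]), add_pow]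
  simp only [one_pow, mul_one, ← pow_mul, Polynomial.finsetSum_coeff]
  rw [Finset.sum_eq_single 1]
  · rw [Polynomial.coeff_mul_natCast, mul_one, Polynomial.coeff_X_pow_self, Nat.choose_one_right]
    push_cast; ring
  · intro b _ hb
    rw [Polynomial.coeff_mul_natCast, Polynomial.coeff_X_pow, if_neg (by omega)]; simp
  · simp

/-- Archimedes: `x₂` is uniformly distributed on `[-1, 1]`. The recursion comes from
`x₀² + x₁² = 1 - x₂²`. -/
theorem coordMoment_even (n : ℕ) : coordMoment (2 * n) = 4 * Real.pi / (2 * n + 1) := by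
  induction n with
  | zero => simp [coordMoment, sphereMeasure_univ]
  | succ n ih =>
    have h0 := integral_sq_mul_pow 0 (by decide) n
    have h1 := integral_sq_mul_pow 1 (by decide) n
    have hs : (∫ x : S2, (((x : E3) 2 : ℝ) : ℂ) ^ (2 * n) * (((x : E3) 0 : ℝ) : ℂ) ^ 2
        ∂sphereMeasure) + (∫ x : S2, (((x : E3) 2 : ℝ) : ℂ) ^ (2 * n) * (((x : E3) 1 : ℝ) : ℂ) ^ 2
        ∂sphereMeasure) = coordMoment (2 * n) - coordMoment (2 * n + 2) := by
      rw [coordMoment, coordMoment, ← integral_add, ← integral_sub]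
      · refine integral_congr_ae (.of_forall fun x => ?_)
        have := congrArg (Complex.ofReal) (sum_sq_coord x)
        push_cast at this
        simp only
        linear_combination (((x : E3) 2 : ℝ) : ℂ) ^ (2 * n) * this
      all_goals exact integrable_of_continuous (by fun_prop)
    have hc : ((2 * n + 2).choose 2 : ℂ) = (n + 1) * (2 * n + 1) := by
      rw [Nat.cast_choose_two]; push_cast; ring
    have hn : ((n : ℂ) + 1) ≠ 0 := by exact_mod_cast Nat.succ_ne_zero n
    have hn2 : (2 * (n : ℂ) + 1) ≠ 0 := by exact_mod_cast Nat.succ_ne_zero (2 * n)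
    have hn3 : (2 * ((n : ℂ) + 1) + 1) ≠ 0 := by exact_mod_cast Nat.succ_ne_zero (2 * (n + 1))
    rw [hc] at h0 h1
    rw [ih] at hs
    rw [show 2 * (n + 1) = 2 * n + 2 by ring]
    push_cast
    rw [eq_div_iff hn3]
    apply mul_left_cancel₀ hn
    have e : (4 * (Real.pi : ℂ)) = 4 * Real.pi / (2 * n + 1) * (2 * n + 1) := by field_simp
    rw [e]
    linear_combination -h0 - h1 + ((n : ℂ) + 1) * (2 * n + 1) * hs

/-- The constant in the moment formula: `4π / (N + 1)` for even `N` and `0` for odd `N`. -/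
theorem coordMoment_eq (N : ℕ) :
    coordMoment N = if Even N then 4 * Real.pi / (N + 1 : ℂ) else 0 := by
  split_ifs with h
  · obtain ⟨n, rfl⟩ := h
    rw [← two_mul, coordMoment_even]; push_cast; rfl
  · exact coordMoment_odd (Nat.not_even_iff_odd.1 h)

/-- The moments of a complex linear form. The two sides are polynomials in `r` at
`a = v + r w` with `v`, `w` real, so that the real case gives `r = i`. -/
theorem integral_lin_pow (a : Fin 3 → ℂ) (n : ℕ) :
    ∫ x, lin a x ^ (2 * n) ∂sphereMeasure = coordMoment (2 * n) * (∑ i, a i ^ 2) ^ n := by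
  set v : E3 := WithLp.toLp 2 fun i => (a i).re
  set w : E3 := WithLp.toLp 2 fun i => (a i).im
  have key : powIntegral (lin fun i => (v i : ℂ)) (lin fun i => (w i : ℂ)) (2 * n)
      = Polynomial.C (coordMoment (2 * n)) *
        (∑ i, (Polynomial.C (v i : ℂ) + Polynomial.X * Polynomial.C (w i : ℂ)) ^ 2) ^ n := by
    refine eq_of_eval_ofReal_eq fun t => ?_
    rw [eval_powIntegral (continuous_lin _) (continuous_lin _)]
    have h := integral_lin_pow_ofReal (v + t • w) (2 * n)
    have hl : ∀ x : S2, lin (fun i => (((v + t • w : E3) i : ℝ) : ℂ)) x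
        = lin (fun i => (v i : ℂ)) x + t * lin (fun i => (w i : ℂ)) x := by
      intro x
      rw [← lin_add_smul]
      congr 1; ext i; simp
    simp_rw [hl] at h
    rw [h, pow_mul, ← Complex.ofReal_pow, EuclideanSpace.real_norm_sq_eq]
    simp only [Polynomial.eval_mul, Polynomial.eval_C, Polynomial.eval_pow,
      Polynomial.eval_finsetSum, Polynomial.eval_add, Polynomial.eval_X]
    rw [mul_comm]
    simp [coordMoment]
  have h := congrArg (Polynomial.eval Complex.I) key
  have ha : ∀ i, (v i : ℂ) + Complex.I * (w i : ℂ) = a i := fun i => by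
    rw [mul_comm]; exact Complex.re_add_im (a i)
  rw [eval_powIntegral (continuous_lin _) (continuous_lin _)] at h
  simp only [← lin_add_smul] at h
  rw [show (fun i => (v i : ℂ)) + Complex.I • (fun i => (w i : ℂ)) = a from funext ha] at h
  simp only [Polynomial.eval_mul, Polynomial.eval_C, Polynomial.eval_pow,
    Polynomial.eval_finsetSum, Polynomial.eval_add, Polynomial.eval_X, ha] at h
  exact h

theorem integral_odd_eq_zero {f : S2 → ℂ}
    (hf : ∀ x, f (rotate (LinearIsometryEquiv.neg ℝ) x) = - f x) :
    ∫ x, f x ∂sphereMeasure = 0 := by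
  have h := integral_rotate (LinearIsometryEquiv.neg ℝ) f
  simp only [hf, integral_neg] at h
  exact self_eq_neg.1 h.symm

theorem lin_neg (a : Fin 3 → ℂ) (x : S2) :
    lin a (rotate (LinearIsometryEquiv.neg ℝ) x) = - lin a x := by
  simp [lin, rotate]

/-- The eigenvalue of the kernel `⟨x, y⟩ ^ n` on spherical harmonics of degree `ℓ`. It vanishes for
odd `n + ℓ`, where `coordMoment` does, and for `n < ℓ`, where the binomial coefficient does. -/
def powEigenvalue (n ℓ : ℕ) : ℂ :=
  coordMoment (n + ℓ) * (((n + ℓ) / 2).choose ℓ * 2 ^ ℓ) / (n + ℓ).choose ℓ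

/-- Integration of a power of a linear form against a power of an isotropic linear form. As `ξ` is
isotropic, `∑ (aᵢ + t ξᵢ)²` is linear in `t`. If `n < ℓ` the exponent `(n + ℓ) / 2 - ℓ` is
truncated, but then `powEigenvalue n ℓ = 0`. -/
theorem integral_lin_pow_mul_lin_pow (a ξ : Fin 3 → ℂ) (hξ : ∑ i, ξ i ^ 2 = 0) (n ℓ : ℕ) :
    ∫ x, lin a x ^ n * lin ξ x ^ ℓ ∂sphereMeasure
      = powEigenvalue n ℓ * (∑ i, a i ^ 2) ^ ((n + ℓ) / 2 - ℓ) * (∑ i, a i * ξ i) ^ ℓ := by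
  rcases Nat.even_or_odd (n + ℓ) with h | h
  · obtain ⟨m, hm⟩ := h
    have hm2 : (n + ℓ) / 2 = m := by omega
    have key : powIntegral (lin a) (lin ξ) (2 * m) = Polynomial.C (coordMoment (2 * m)) *
        (Polynomial.C (2 * ∑ i, a i * ξ i) * Polynomial.X + Polynomial.C (∑ i, a i ^ 2)) ^ m := by
      refine eq_of_eval_ofReal_eq fun t => ?_
      rw [eval_powIntegral (continuous_lin _) (continuous_lin _)]
      simp only [← lin_add_smul]
      rw [integral_lin_pow]
      have : ∑ i, (a + (t : ℂ) • ξ) i ^ 2 = 2 * (∑ i, a i * ξ i) * t + ∑ i, a i ^ 2 := by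
        simp only [Fin.sum_univ_three] at hξ ⊢
        simp
        linear_combination (t : ℂ) ^ 2 * hξ
      rw [this]
      simp only [Polynomial.eval_mul, Polynomial.eval_C, Polynomial.eval_pow, Polynomial.eval_add,
        Polynomial.eval_X]
    have h2 := coeff_powIntegral (lin a) (lin ξ) (N := 2 * m) (j := ℓ) (by omega)
    have h0 : ((n + ℓ).choose ℓ : ℂ) ≠ 0 := by
      exact_mod_cast (Nat.choose_pos (by omega)).ne'
    rw [key, show 2 * m - ℓ = n by omega, show 2 * m = n + ℓ by omega, Polynomial.coeff_C_mul,
      add_pow] at h2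
    rw [powEigenvalue, hm2]
    simp only [mul_pow, ← Polynomial.C_pow, Polynomial.finsetSum_coeff,
      Polynomial.coeff_mul_natCast, Polynomial.coeff_mul_C, Polynomial.coeff_C_mul,
      Polynomial.coeff_X_pow] at h2
    rw [eq_comm] at h2
    rw [← mul_right_inj' h0, h2]
    by_cases hl : ℓ ≤ m
    · rw [Finset.sum_eq_single ℓ]
      · simp; field_simp
      · intro b _ hb; simp [hb.symm]
      · intro hb; exact absurd (Finset.mem_range.2 (by omega)) hb
    · rw [Finset.sum_eq_zero]
      · simp [Nat.choose_eq_zero_of_lt (not_le.1 hl)]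
      · intro b hb
        rw [if_neg]; · simp
        have := Finset.mem_range.1 hb; omega
  · rw [powEigenvalue, coordMoment_odd h, integral_odd_eq_zero]
    · simp
    · intro x
      rw [lin_neg, lin_neg, neg_pow, neg_pow (lin ξ x)]
      have : (-1 : ℂ) ^ n * (-1) ^ ℓ = -1 := by rw [← pow_add, h.neg_one_pow]
      linear_combination lin a x ^ n * lin ξ x ^ ℓ * this

/-! ### Isotropic vectors and generating polynomials -/

/-- The complex coordinate `x₀ + i x₁`. -/
def planar (x : S2) : ℂ := ⟨(x : E3) 0, (x : E3) 1⟩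

/-- A curve of isotropic vectors of `ℂ³`: `∑ ξᵢ(s)² = 0`. -/
def isoVec (s : ℂ) : Fin 3 → ℂ :=
  ![(s ^ 2 - 1) / 2, Complex.I * (s ^ 2 + 1) / 2, s]

/-- The curve of isotropic vectors conjugate to `isoVec`. -/
def isoVecConj (s : ℂ) : Fin 3 → ℂ :=
  ![(s ^ 2 - 1) / 2, -(Complex.I * (s ^ 2 + 1) / 2), s]

/-- The polynomial `s ↦ ⟨x, ξ(s)⟩`. -/
def basePoly (x : S2) : ℂ[X] :=
  Polynomial.C (planar x / 2) * Polynomial.X ^ 2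
    + Polynomial.C (((x : E3) 2 : ℝ) : ℂ) * Polynomial.X - Polynomial.C (starRingEnd ℂ (planar x) / 2)

/-- The generating polynomial `s ↦ ⟨x, ξ(s)⟩ ^ ℓ` of the harmonics of degree `ℓ`. -/
def genPoly (ℓ : ℕ) (x : S2) : ℂ[X] := basePoly x ^ ℓ

theorem continuous_planar : Continuous planar := by
  have : planar = fun x : S2 => (((x : E3) 0 : ℝ) : ℂ) + (((x : E3) 1 : ℝ) : ℂ) * Complex.I := by
    ext x; exact (Complex.mk_eq_add_mul_I _ _)
  rw [this]; fun_prop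

theorem planar_eq (x : S2) :
    planar x = (((x : E3) 0 : ℝ) : ℂ) + (((x : E3) 1 : ℝ) : ℂ) * Complex.I :=
  Complex.mk_eq_add_mul_I _ _

theorem conj_planar_eq (x : S2) : starRingEnd ℂ (planar x)
    = (((x : E3) 0 : ℝ) : ℂ) - (((x : E3) 1 : ℝ) : ℂ) * Complex.I := by
  rw [planar_eq]; simp [sub_eq_add_neg]

theorem planar_mul_conj (x : S2) :
    planar x * starRingEnd ℂ (planar x) = 1 - (((x : E3) 2 : ℝ) : ℂ) ^ 2 := by
  have := congrArg (Complex.ofReal) (sum_sq_coord x)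
  push_cast at this
  rw [conj_planar_eq, planar_eq]
  linear_combination this - (((x : E3) 1 : ℝ) : ℂ) ^ 2 * Complex.I_sq

theorem continuous_coeff_genPoly (ℓ j : ℕ) : Continuous fun x => (genPoly ℓ x).coeff j := by
  have hb : ∀ j, Continuous fun x => (basePoly x).coeff j := by
    intro j
    have := continuous_planar
    simp only [basePoly, Polynomial.coeff_sub, Polynomial.coeff_add, Polynomial.coeff_C_mul,
      Polynomial.coeff_C]
    split_ifs <;> fun_prop
  induction ℓ generalizing j with
  | zero => simp only [genPoly, pow_zero]; fun_prop
  | succ ℓ ih =>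
    simp only [genPoly, pow_succ, Polynomial.coeff_mul] at ih ⊢
    exact continuous_finsetSum _ fun i _ => (ih _).mul (hb _)

theorem natDegree_genPoly_le (ℓ : ℕ) (x : S2) : (genPoly ℓ x).natDegree ≤ 2 * ℓ := by
  have : (basePoly x).natDegree ≤ 2 := by unfold basePoly; compute_degree
  rw [genPoly, mul_comm]
  exact Polynomial.natDegree_pow_le_of_le ℓ this

theorem eval_genPoly (ℓ : ℕ) (x : S2) (s : ℂ) :
    (genPoly ℓ x).eval s = lin (isoVec s) x ^ ℓ := by
  rw [genPoly, Polynomial.eval_pow]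
  congr 1
  simp [basePoly, lin, Fin.sum_univ_three, isoVec, planar_eq]
  ring

theorem eval_genPoly_conj (ℓ : ℕ) (x : S2) (s : ℂ) :
    ((genPoly ℓ x).map (starRingEnd ℂ)).eval s = lin (isoVecConj s) x ^ ℓ := by
  rw [genPoly, Polynomial.map_pow, Polynomial.eval_pow]
  congr 1
  have h2 : starRingEnd ℂ 2 = 2 := Complex.conj_ofNat 2
  simp [basePoly, lin, Fin.sum_univ_three, isoVecConj, planar_eq, h2]
  ring

theorem isoVec_sq (s : ℂ) : ∑ i, isoVec s i ^ 2 = 0 := by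
  simp [Fin.sum_univ_three, isoVec]
  linear_combination (s ^ 2 + 1) ^ 2 / 4 * Complex.I_sq

/-- Integration commutes with the extraction of a coefficient. -/
theorem integral_mul_coeff {F : S2 → ℂ[X]} {D : ℕ} (hF : ∀ j, Continuous fun x => (F x).coeff j)
    (hD : ∀ x, (F x).natDegree ≤ D) {h : S2 → ℂ} (hh : Continuous h) {q : ℂ[X]}
    (hq : ∀ s, ∫ x, h x * (F x).eval s ∂sphereMeasure = q.eval s) (j : ℕ) :
    ∫ x, h x * (F x).coeff j ∂sphereMeasure = q.coeff j := by
  have key : q = ∑ j ∈ Finset.range (D + 1),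
      Polynomial.monomial j (∫ x, h x * (F x).coeff j ∂sphereMeasure) := by
    refine Polynomial.funext fun s => ?_
    rw [← hq]
    have : ∀ x, h x * (F x).eval s
        = ∑ j ∈ Finset.range (D + 1), (h x * (F x).coeff j) * s ^ j := by
      intro x
      rw [Polynomial.eval_eq_sum_range' (Nat.lt_succ_of_le (hD x)), Finset.mul_sum]
      simp only [mul_assoc]
    simp_rw [this]
    rw [integral_finsetSum _ fun j _ =>
      (integrable_of_continuous (f := fun x => h x * (F x).coeff j)
        (hh.mul (hF j))).mul_const (s ^ j)]
    simp_rw [integral_mul_const, Polynomial.eval_finsetSum, Polynomial.eval_monomial]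
  rw [key, Polynomial.finsetSum_coeff]
  simp only [Polynomial.coeff_monomial]
  rw [Finset.sum_ite_eq' (Finset.range (D + 1)) j]
  split_ifs with hj
  · rfl
  · have : ∀ x, (F x).coeff j = 0 := fun x =>
      Polynomial.coeff_eq_zero_of_natDegree_lt (by have := hD x; simp at hj; omega)
    simp [this]

/-- The coefficients of the generating polynomial are eigenfunctions of the kernels `⟨x, y⟩ ^ n`. -/
theorem integral_pow_mul_coeff_genPoly (n ℓ j : ℕ) (y : S2) :
    ∫ x, ((inner ℝ (x : E3) (y : E3) : ℝ) : ℂ) ^ n * (genPoly ℓ x).coeff j ∂sphereMeasure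
      = powEigenvalue n ℓ * (genPoly ℓ y).coeff j := by
  rw [← Polynomial.coeff_C_mul]
  refine integral_mul_coeff (continuous_coeff_genPoly ℓ) (natDegree_genPoly_le ℓ) (by fun_prop) ?_ j
  intro s
  simp_rw [eval_genPoly, ← lin_ofReal]
  rw [integral_lin_pow_mul_lin_pow _ _ (isoVec_sq s), Polynomial.eval_mul, Polynomial.eval_C,
    eval_genPoly]
  have : ∑ i, (((y : E3) i : ℝ) : ℂ) ^ 2 = 1 := by
    have := congrArg (Complex.ofReal) (sum_sq_coord y)
    push_cast at this
    rw [Fin.sum_univ_three, this]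
  rw [this, one_pow, mul_one]
  congr 2
  simp only [lin, mul_comm]

/-- The norm of a coefficient of the generating polynomial, read off from
`⟨ξ̄(σ), ξ(s)⟩ = (1 + σ s)² / 2` by extraction of the coefficients in `s` and in `σ`. -/
theorem integral_coeff_mul_conj_coeff (ℓ j : ℕ) :
    ∫ x, (genPoly ℓ x).coeff j * starRingEnd ℂ ((genPoly ℓ x).coeff j) ∂sphereMeasure
      = powEigenvalue ℓ ℓ * (1 / 2) ^ ℓ * (2 * ℓ).choose j := by
  have h1 : ∀ σ : ℂ, ∫ x, lin (isoVecConj σ) x ^ ℓ * (genPoly ℓ x).coeff j ∂sphereMeasure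
      = powEigenvalue ℓ ℓ * (1 / 2) ^ ℓ * (2 * ℓ).choose j * σ ^ j := by
    intro σ
    rw [integral_mul_coeff (continuous_coeff_genPoly ℓ) (natDegree_genPoly_le ℓ)
      (h := fun x => lin (isoVecConj σ) x ^ ℓ)
      ((continuous_lin _).pow ℓ) (q := Polynomial.C (powEigenvalue ℓ ℓ * (1 / 2) ^ ℓ) *
        ((1 + Polynomial.X) ^ (2 * ℓ)).comp (Polynomial.C σ * Polynomial.X))]
    · rw [Polynomial.coeff_C_mul, Polynomial.comp_C_mul_X_coeff, Polynomial.coeff_one_add_X_pow]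
      ring
    · intro s
      simp_rw [eval_genPoly]
      rw [integral_lin_pow_mul_lin_pow _ _ (isoVec_sq s)]
      have : ∑ i, isoVecConj σ i * isoVec s i = 1 / 2 * (1 + σ * s) ^ 2 := by
        simp [Fin.sum_univ_three, isoVec, isoVecConj]
        linear_combination -(σ ^ 2 + 1) * (s ^ 2 + 1) / 4 * Complex.I_sq
      rw [this, show (ℓ + ℓ) / 2 - ℓ = 0 by omega, mul_pow, ← pow_mul]
      simp
      ring
  have h2 := integral_mul_coeff (F := fun x => (genPoly ℓ x).map (starRingEnd ℂ)) (D := 2 * ℓ)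
    (h := fun x => (genPoly ℓ x).coeff j)
    (q := Polynomial.monomial j (powEigenvalue ℓ ℓ * (1 / 2) ^ ℓ * (2 * ℓ).choose j))
    (fun i => by
      simp only [Polynomial.coeff_map]
      exact Complex.continuous_conj.comp (continuous_coeff_genPoly ℓ i))
    (fun x => Polynomial.natDegree_map_le.trans (natDegree_genPoly_le ℓ x))
    (continuous_coeff_genPoly ℓ j) (fun s => by
      simp_rw [eval_genPoly_conj, mul_comm ((genPoly ℓ _).coeff j)]
      rw [h1, Polynomial.eval_monomial]) j
  simpa [Polynomial.coeff_map] using h2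

/-- The square of a coefficient off the centre integrates to zero, because
`⟨ξ(σ), ξ(s)⟩ = -(s - σ)² / 2` pairs the power `ℓ + k` of `s` with the power `ℓ - k` of `σ`. -/
theorem integral_coeff_sq (ℓ k : ℕ) (hk : 0 < k) :
    ∫ x, (genPoly ℓ x).coeff (ℓ + k) * (genPoly ℓ x).coeff (ℓ + k) ∂sphereMeasure = 0 := by
  have h1 : ∀ σ : ℂ, ∫ x, lin (isoVec σ) x ^ ℓ * (genPoly ℓ x).coeff (ℓ + k) ∂sphereMeasure
      = powEigenvalue ℓ ℓ * (-1 / 2) ^ ℓ *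
        ((-σ) ^ (2 * ℓ - (ℓ + k)) * (2 * ℓ).choose (ℓ + k)) := by
    intro σ
    rw [integral_mul_coeff (continuous_coeff_genPoly ℓ) (natDegree_genPoly_le ℓ)
      (h := fun x => lin (isoVec σ) x ^ ℓ)
      ((continuous_lin _).pow ℓ) (q := Polynomial.C (powEigenvalue ℓ ℓ * (-1 / 2) ^ ℓ) *
        ((Polynomial.X + Polynomial.C (-σ)) ^ (2 * ℓ)))]
    · rw [Polynomial.coeff_C_mul, Polynomial.coeff_X_add_C_pow]
    · intro s
      simp_rw [eval_genPoly]
      rw [integral_lin_pow_mul_lin_pow _ _ (isoVec_sq s)]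
      have : ∑ i, isoVec σ i * isoVec s i = -1 / 2 * (s + -σ) ^ 2 := by
        simp [Fin.sum_univ_three, isoVec]
        linear_combination (σ ^ 2 + 1) * (s ^ 2 + 1) / 4 * Complex.I_sq
      rw [this, show (ℓ + ℓ) / 2 - ℓ = 0 by omega, mul_pow, ← pow_mul]
      simp
      ring
  rw [integral_mul_coeff (q := Polynomial.C (powEigenvalue ℓ ℓ * (-1 / 2) ^ ℓ *
      (2 * ℓ).choose (ℓ + k)) * (Polynomial.C (-1) * Polynomial.X) ^ (2 * ℓ - (ℓ + k)))
    (continuous_coeff_genPoly ℓ) (natDegree_genPoly_le ℓ) (continuous_coeff_genPoly ℓ (ℓ + k))]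
  · rcases le_or_gt (ℓ + k) (2 * ℓ) with h | h
    · rw [mul_pow, ← Polynomial.C_pow, Polynomial.coeff_C_mul, Polynomial.coeff_C_mul,
        Polynomial.coeff_X_pow, if_neg (by omega)]
      simp
    · simp [Nat.choose_eq_zero_of_lt h]
  · intro s
    simp_rw [eval_genPoly, mul_comm ((genPoly ℓ _).coeff (ℓ + k))]
    rw [h1]
    simp
    ring

/-! ### Legendre polynomials and complex spherical harmonics -/

/-- Rodrigues' formula read as a Taylor expansion of `(u² - 1)^ℓ` at `z`. -/
theorem eval_derivative_legendreP (ℓ k : ℕ) (z : ℝ) :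
    (Polynomial.derivative^[k] (legendreP ℓ)).eval z
      = ((ℓ + k).factorial / (2 ^ ℓ * ℓ.factorial)) *
        (Polynomial.taylor z ((Polynomial.X ^ 2 - 1) ^ ℓ)).coeff (ℓ + k) := by
  rw [Polynomial.taylor_coeff, legendreP, Polynomial.iterate_derivative_C_mul,
    ← Function.iterate_add_apply, add_comm k ℓ, ← Polynomial.factorial_smul_hasseDeriv]
  simp
  ring

/-- The complex harmonic `(x₀ + i x₁)^k P_ℓ^{(k)}(x₂)`. -/
def assocHarm (ℓ k : ℕ) (x : S2) : ℂ :=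
  planar x ^ k * (((Polynomial.derivative^[k] (legendreP ℓ)).eval ((x : E3) 2) : ℝ) : ℂ)

/-- With `w = x₀ + i x₁`, the polynomial `2 w ⟨x, ξ(s)⟩` in `s` is `(x₂ + w s)² - 1`, which links
the generating polynomial to Rodrigues' formula. -/
theorem two_planar_pow_mul_coeff (ℓ j : ℕ) (x : S2) :
    (2 * planar x) ^ ℓ * (genPoly ℓ x).coeff j
      = planar x ^ j *
        (((Polynomial.taylor ((x : E3) 2) ((Polynomial.X ^ 2 - 1) ^ ℓ)).coeff j : ℝ) : ℂ) := by
  set z := (x : E3) 2 with hz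
  have key : Polynomial.C (2 * planar x) * basePoly x
      = ((Polynomial.taylor z (Polynomial.X ^ 2 - 1)).map Complex.ofRealHom).comp
        (Polynomial.C (planar x) * Polynomial.X) := by
    refine Polynomial.funext fun s => ?_
    simp [basePoly, Polynomial.taylor_apply, ← hz]
    linear_combination - planar_mul_conj x
  have h2 := congrArg (fun p => (p ^ ℓ).coeff j) key
  simp only [mul_pow, ← Polynomial.C_pow, Polynomial.coeff_C_mul, ← Polynomial.pow_comp,
    ← Polynomial.map_pow, Polynomial.comp_C_mul_X_coeff, Polynomial.coeff_map] at h2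
  rw [genPoly, mul_pow, h2, mul_comm]
  simp [Polynomial.taylor_pow]

theorem coeff_taylor_of_sq_eq_one (ℓ : ℕ) {z : ℝ} (hz : z ^ 2 = 1) :
    (Polynomial.taylor z ((Polynomial.X ^ 2 - 1) ^ ℓ)).coeff ℓ = (2 * z) ^ ℓ := by
  have : Polynomial.taylor z ((Polynomial.X ^ 2 - 1 : ℝ[X]) ^ ℓ)
      = (Polynomial.X + Polynomial.C (2 * z)) ^ ℓ * Polynomial.X ^ ℓ := by
    refine Polynomial.funext fun s => ?_
    simp only [Polynomial.taylor_apply]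
    simp [← mul_pow]
    congr 1
    linear_combination hz
  rw [this, Polynomial.coeff_mul_X_pow', if_pos le_rfl, Polynomial.coeff_X_add_C_pow]
  simp

theorem eval_legendreP_of_sq_eq_one (ℓ : ℕ) {z : ℝ} (hz : z ^ 2 = 1) :
    (legendreP ℓ).eval z = z ^ ℓ := by
  have h := eval_derivative_legendreP ℓ 0 z
  simp only [Function.iterate_zero, id, add_zero] at h
  rw [h, coeff_taylor_of_sq_eq_one ℓ hz, mul_pow]
  have := Nat.factorial_ne_zero ℓ
  field_simp

/-- The harmonics of degree `ℓ` are coefficients of the generating polynomial. -/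
theorem assocHarm_eq (ℓ k : ℕ) (x : S2) :
    assocHarm ℓ k x = ((ℓ + k).factorial / ℓ.factorial) * (genPoly ℓ x).coeff (ℓ + k) := by
  have hf : (ℓ.factorial : ℂ) ≠ 0 := by exact_mod_cast Nat.factorial_ne_zero ℓ
  -- At the poles the factor `(2 w)^ℓ` cannot be cancelled, and both sides are computed directly.
  by_cases hw : planar x = 0
  · have hz : ((x : E3) 2 : ℝ) ^ 2 = (1 : ℝ) := by
      have := planar_mul_conj x
      rw [hw, zero_mul] at this
      have h2 : (((x : E3) 2 : ℝ) : ℂ) ^ 2 = 1 := by linear_combination this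
      exact_mod_cast h2
    have hg : genPoly ℓ x = Polynomial.C ((((x : E3) 2 : ℝ) : ℂ) ^ ℓ) * Polynomial.X ^ ℓ := by
      simp [genPoly, basePoly, hw, mul_pow]
    rw [hg, assocHarm, hw, Polynomial.coeff_C_mul, Polynomial.coeff_X_pow]
    rcases Nat.eq_zero_or_pos k with rfl | hk
    · simp [eval_legendreP_of_sq_eq_one ℓ hz, hf]
    · simp [hk.ne']
  · have h := two_planar_pow_mul_coeff ℓ (ℓ + k) x
    have h2 : (2 * planar x) ^ ℓ ≠ 0 := pow_ne_zero _ (mul_ne_zero two_ne_zero hw)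
    rw [assocHarm, eval_derivative_legendreP]
    apply mul_left_cancel₀ h2
    push_cast
    rw [mul_left_comm _ (_ / _ : ℂ) ((genPoly ℓ x).coeff _), h, pow_add, mul_pow]
    field_simp

theorem continuous_assocHarm (ℓ k : ℕ) : Continuous (assocHarm ℓ k) := by
  have : assocHarm ℓ k = fun x => ((ℓ + k).factorial / ℓ.factorial : ℂ) *
    (genPoly ℓ x).coeff (ℓ + k) := funext (assocHarm_eq ℓ k)
  rw [this]
  exact continuous_const.mul (continuous_coeff_genPoly _ _)

theorem integral_pow_mul_assocHarm (n ℓ k : ℕ) (y : S2) :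
    ∫ x, ((inner ℝ (x : E3) (y : E3) : ℝ) : ℂ) ^ n * assocHarm ℓ k x ∂sphereMeasure
      = powEigenvalue n ℓ * assocHarm ℓ k y := by
  simp_rw [assocHarm_eq, mul_left_comm _ (_ / _ : ℂ)]
  rw [integral_const_mul, integral_pow_mul_coeff_genPoly]

theorem powEigenvalue_self (ℓ : ℕ) :
    powEigenvalue ℓ ℓ = 4 * Real.pi / (2 * ℓ + 1) * 2 ^ ℓ / (2 * ℓ).choose ℓ := by
  rw [powEigenvalue, ← two_mul, coordMoment_even, Nat.mul_div_cancel_left _ two_pos,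
    Nat.choose_self, Nat.cast_one, one_mul]

theorem integral_normSq_assocHarm {ℓ k : ℕ} (hk : k ≤ ℓ) :
    ∫ x, Complex.normSq (assocHarm ℓ k x) ∂sphereMeasure
      = 4 * Real.pi / (2 * ℓ + 1) * ((ℓ + k).factorial / (ℓ - k).factorial) := by
  apply Complex.ofReal_injective
  rw [← integral_complex_ofReal]
  simp_rw [← Complex.mul_conj, assocHarm_eq]
  have : ∀ x, ((ℓ + k).factorial / ℓ.factorial : ℂ) * (genPoly ℓ x).coeff (ℓ + k) *
      starRingEnd ℂ (((ℓ + k).factorial / ℓ.factorial : ℂ) * (genPoly ℓ x).coeff (ℓ + k))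
      = ((ℓ + k).factorial / ℓ.factorial : ℂ) ^ 2 *
        ((genPoly ℓ x).coeff (ℓ + k) * starRingEnd ℂ ((genPoly ℓ x).coeff (ℓ + k))) := by
    intro x; simp only [map_mul, map_div₀, map_natCast]; ring
  simp_rw [this]
  rw [integral_const_mul, integral_coeff_mul_conj_coeff, powEigenvalue_self]
  have h1 : (ℓ.factorial : ℂ) ≠ 0 := by exact_mod_cast Nat.factorial_ne_zero ℓ
  have h2 : ((ℓ - k).factorial : ℂ) ≠ 0 := by exact_mod_cast Nat.factorial_ne_zero _
  have h3 : ((ℓ + k).factorial : ℂ) ≠ 0 := by exact_mod_cast Nat.factorial_ne_zero _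
  have h4 : ((2 * ℓ).factorial : ℂ) ≠ 0 := by exact_mod_cast Nat.factorial_ne_zero _
  have h5 : (2 * (ℓ : ℂ) + 1) ≠ 0 := by exact_mod_cast Nat.succ_ne_zero (2 * ℓ)
  rw [Nat.cast_choose ℂ (show ℓ ≤ 2 * ℓ by omega), Nat.cast_choose ℂ (show ℓ + k ≤ 2 * ℓ by omega),
    show 2 * ℓ - ℓ = ℓ by omega, show 2 * ℓ - (ℓ + k) = ℓ - k by omega, one_div, inv_pow]
  push_cast
  field_simp

theorem integral_sq_assocHarm {ℓ k : ℕ} (hk : 0 < k) :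
    ∫ x, assocHarm ℓ k x ^ 2 ∂sphereMeasure = 0 := by
  have : ∀ x, assocHarm ℓ k x ^ 2 = ((ℓ + k).factorial / ℓ.factorial : ℂ) ^ 2 *
        ((genPoly ℓ x).coeff (ℓ + k) * (genPoly ℓ x).coeff (ℓ + k)) := by
    intro x; rw [assocHarm_eq]; ring
  simp_rw [this]
  rw [integral_const_mul, integral_coeff_sq ℓ k hk, mul_zero]

/-- The integral of a polynomial in `x₂` over the sphere. -/
theorem integral_eval_coord (q : ℝ[X]) :
    ∫ x : S2, q.eval ((x : E3) 2) ∂sphereMeasure = 2 * Real.pi * ∫ z in (-1 : ℝ)..1, q.eval z := by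
  induction q using Polynomial.induction_on' with
  | add p q hp hq =>
    simp only [Polynomial.eval_add]
    rw [integral_add, intervalIntegral.integral_add, hp, hq, mul_add]
    · exact p.continuous.intervalIntegrable _ _
    · exact q.continuous.intervalIntegrable _ _
    · exact integrable_of_continuous (p.continuous.comp (by fun_prop))
    · exact integrable_of_continuous (q.continuous.comp (by fun_prop))
  | monomial n a =>
    simp only [Polynomial.eval_monomial]
    rw [integral_const_mul, intervalIntegral.integral_const_mul, integral_pow]
    have h : ∫ x : S2, ((x : E3) 2) ^ n ∂sphereMeasure
        = if Even n then 4 * Real.pi / (n + 1 : ℝ) else 0 := by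
      apply Complex.ofReal_injective
      rw [← integral_complex_ofReal]
      have := coordMoment_eq n
      rw [coordMoment] at this
      push_cast
      rw [this]
      split_ifs <;> push_cast <;> rfl
    rw [h]
    split_ifs with hn
    · rw [hn.add_one.neg_one_pow]; simp; ring
    · rw [(Nat.not_even_iff_odd.1 hn).add_one.neg_one_pow]; simp

theorem legendreCoeff_eval (q : ℝ[X]) (ℓ : ℕ) :
    legendreCoeff (fun z => q.eval z) ℓ
      = ∫ x : S2, q.eval ((x : E3) 2) * (legendreP ℓ).eval ((x : E3) 2) ∂sphereMeasure := by
  simp only [legendreCoeff, ← Polynomial.eval_mul]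
  rw [integral_eval_coord]

/-- The north pole. -/
def northPole : S2 := ⟨EuclideanSpace.single 2 1, by simp⟩

theorem assocHarm_zero (ℓ : ℕ) (x : S2) :
    assocHarm ℓ 0 x = (((legendreP ℓ).eval ((x : E3) 2) : ℝ) : ℂ) := by
  simp [assocHarm]

/-- The eigenvalue of the kernel is its Legendre coefficient, by evaluation of the eigenvalue
equation for `P_ℓ(x₂)` at the north pole. -/
theorem powEigenvalue_eq (n ℓ : ℕ) :
    powEigenvalue n ℓ = ((legendreCoeff (fun z => z ^ n) ℓ : ℝ) : ℂ) := by
  have h := integral_pow_mul_assocHarm n ℓ 0 northPole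
  have h1 : assocHarm ℓ 0 northPole = 1 := by
    rw [assocHarm_zero, eval_legendreP_of_sq_eq_one ℓ] <;> simp [northPole]
  have h2 := legendreCoeff_eval (Polynomial.X ^ n) ℓ
  simp only [Polynomial.eval_pow, Polynomial.eval_X] at h2
  rw [h1, mul_one] at h
  rw [← h, h2, ← integral_complex_ofReal]
  refine integral_congr_ae (.of_forall fun x => ?_)
  simp [assocHarm_zero, northPole, EuclideanSpace.inner_single_right]

/-- Funk–Hecke formula for a polynomial kernel. -/
theorem integral_eval_mul_assocHarm (q : ℝ[X]) (ℓ k : ℕ) (y : S2) :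
    ∫ x, ((q.eval (inner ℝ (x : E3) (y : E3)) : ℝ) : ℂ) * assocHarm ℓ k x ∂sphereMeasure
      = ((legendreCoeff (fun z => q.eval z) ℓ : ℝ) : ℂ) * assocHarm ℓ k y := by
  have hc := continuous_assocHarm ℓ k
  induction q using Polynomial.induction_on' with
  | add p q hp hq =>
    have hl : legendreCoeff (fun z => (p + q).eval z) ℓ
        = legendreCoeff (fun z => p.eval z) ℓ + legendreCoeff (fun z => q.eval z) ℓ := by
      simp only [legendreCoeff, Polynomial.eval_add, add_mul]
      rw [intervalIntegral.integral_add, mul_add]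
      · exact (p.continuous.mul (legendreP ℓ).continuous).intervalIntegrable _ _
      · exact (q.continuous.mul (legendreP ℓ).continuous).intervalIntegrable _ _
    rw [hl, Complex.ofReal_add, add_mul, ← hp, ← hq, ← integral_add]
    · simp [add_mul]
    · exact integrable_of_continuous ((Complex.continuous_ofReal.comp
        (p.continuous.comp (by fun_prop))).mul hc)
    · exact integrable_of_continuous ((Complex.continuous_ofReal.comp
        (q.continuous.comp (by fun_prop))).mul hc)
  | monomial n a =>
    have hl : legendreCoeff (fun z => (Polynomial.monomial n a).eval z) ℓ
        = a * legendreCoeff (fun z => z ^ n) ℓ := by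
      simp only [legendreCoeff, Polynomial.eval_monomial, mul_assoc]
      rw [intervalIntegral.integral_const_mul]; ring
    rw [hl, Complex.ofReal_mul, ← powEigenvalue_eq, mul_assoc, ← integral_pow_mul_assocHarm,
      ← integral_const_mul]
    simp [mul_assoc]

/-! ### Real spherical harmonics and the Funk–Hecke formula -/

theorem inner_mem_Icc (x y : S2) : inner ℝ (x : E3) (y : E3) ∈ Set.Icc (-1 : ℝ) 1 := by
  have := abs_real_inner_le_norm (x : E3) (y : E3)
  simp only [norm_eq_of_mem_sphere, mul_one] at this
  exact abs_le.1 this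

theorem exists_coord_eq {u : ℝ} (hu : u ∈ Set.Icc (-1 : ℝ) 1) : ∃ x : S2, (x : E3) 2 = u := by
  have h : 0 ≤ 1 - u ^ 2 := by nlinarith [hu.1, hu.2]
  refine ⟨⟨WithLp.toLp 2 ![Real.sqrt (1 - u ^ 2), 0, u], ?_⟩, rfl⟩
  rw [mem_sphere_zero_iff_norm, ← sq_eq_sq₀ (norm_nonneg _) zero_le_one,
    EuclideanSpace.real_norm_sq_eq, Fin.sum_univ_three]
  simp [Real.sq_sqrt h]

/-- On the unit circle `⟨x, ξ(s)⟩ = s (x₂ + i Im (s w))` with `w = x₀ + i x₁`. -/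
theorem norm_eval_basePoly_le (x : S2) {s : ℂ} (hs : ‖s‖ = 1) : ‖(basePoly x).eval s‖ ≤ 1 := by
  set z := (x : E3) 2 with hz
  have hss : s * starRingEnd ℂ s = 1 := by
    rw [Complex.mul_conj, Complex.normSq_eq_norm_sq, hs]; simp
  have h1 : (basePoly x).eval s = s * ((z : ℂ) + ((s * planar x).im : ℂ) * Complex.I) := by
    rw [Complex.im_eq_sub_conj]
    simp only [basePoly, Polynomial.eval_add, Polynomial.eval_sub, Polynomial.eval_mul,
      Polynomial.eval_C, Polynomial.eval_pow, Polynomial.eval_X, map_mul, ← hz]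
    field_simp
    linear_combination starRingEnd ℂ (planar x) * hss
  rw [h1, norm_mul, hs, one_mul, ← sq_le_one_iff₀ (norm_nonneg _), ← Complex.normSq_eq_norm_sq,
    Complex.normSq_add_mul_I]
  have h2 : (s * planar x).im ^ 2 ≤ Complex.normSq (s * planar x) := by
    rw [Complex.normSq_apply]; nlinarith [sq_nonneg (s * planar x).re]
  have h3 : Complex.normSq (s * planar x) = 1 - z ^ 2 := by
    rw [map_mul, Complex.normSq_eq_norm_sq s, hs]
    apply Complex.ofReal_injective
    have := planar_mul_conj x
    rw [Complex.mul_conj] at this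
    push_cast
    rw [this]; simp [← hz]
  linarith

/-- `|P_ℓ| ≤ 1` on `[-1, 1]`, because `P_ℓ(x₂)` is a coefficient of a polynomial bounded by one on
the unit circle. -/
theorem abs_eval_legendreP_le {u : ℝ} (hu : u ∈ Set.Icc (-1 : ℝ) 1) (ℓ : ℕ) :
    |(legendreP ℓ).eval u| ≤ 1 := by
  obtain ⟨x, rfl⟩ := exists_coord_eq hu
  have h := Polynomial.sum_sq_norm_coeff_eq_circleAverage (genPoly ℓ x)
  have hle : Real.circleAverage (fun θ ↦ ‖(genPoly ℓ x).eval θ‖ ^ 2) 0 1 ≤ 1 := by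
    refine Real.circleAverage_mono_on_of_le_circle ?_ ?_
    · apply ContinuousOn.circleIntegrable zero_le_one
      fun_prop
    · intro s hs
      have hs1 : ‖s‖ = 1 := by simpa using hs
      rw [genPoly, Polynomial.eval_pow, norm_pow]
      exact pow_le_one₀ (pow_nonneg (norm_nonneg _) _)
        (pow_le_one₀ (norm_nonneg _) (norm_eval_basePoly_le x hs1))
  have hc : ‖(genPoly ℓ x).coeff ℓ‖ ^ 2 ≤ 1 := by
    refine le_trans ?_ (h.le.trans hle)
    by_cases hm : ℓ ∈ (genPoly ℓ x).support
    · exact Finset.single_le_sum (f := fun i => ‖(genPoly ℓ x).coeff i‖ ^ 2)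
        (fun i _ => by positivity) hm
    · rw [Polynomial.notMem_support_iff.1 hm]
      rw [norm_zero, zero_pow two_ne_zero]
      exact Finset.sum_nonneg fun i _ => by positivity
  have h2 := assocHarm_eq ℓ 0 x
  have hf : (ℓ.factorial : ℂ) ≠ 0 := by exact_mod_cast Nat.factorial_ne_zero ℓ
  rw [assocHarm_zero, add_zero, div_self hf, one_mul] at h2
  rw [← h2, sq_le_one_iff₀ (norm_nonneg _), Complex.norm_real] at hc
  exact hc

theorem integral_sq_legendreP (ℓ : ℕ) :
    ∫ x : S2, (legendreP ℓ).eval ((x : E3) 2) ^ 2 ∂sphereMeasure = 4 * Real.pi / (2 * ℓ + 1) := by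
  have h := integral_normSq_assocHarm (Nat.zero_le ℓ)
  simp_rw [assocHarm_zero, Complex.normSq_ofReal, ← pow_two] at h
  rw [h]
  simp [Nat.factorial_ne_zero]

theorem natDegree_legendreP_le (ℓ : ℕ) : (legendreP ℓ).natDegree ≤ ℓ := by
  rw [legendreP]
  refine (Polynomial.natDegree_C_mul_le _ _).trans ?_
  refine (Polynomial.natDegree_iterate_derivative _ _).trans ?_
  have : ((Polynomial.X ^ 2 - 1 : ℝ[X]) ^ ℓ).natDegree ≤ ℓ * 2 :=
    Polynomial.natDegree_pow_le_of_le ℓ (by compute_degree)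
  omega

theorem legendreCoeff_pow_eq_zero {n ℓ : ℕ} (h : n < ℓ) : legendreCoeff (fun z => z ^ n) ℓ = 0 := by
  apply Complex.ofReal_injective
  rw [← powEigenvalue_eq, powEigenvalue, Nat.choose_eq_zero_of_lt (by omega)]
  simp

theorem legendreCoeff_legendreP_of_lt {i ℓ : ℕ} (h : i < ℓ) :
    legendreCoeff (fun z => (legendreP i).eval z) ℓ = 0 := by
  have : ∀ z, (legendreP i).eval z * (legendreP ℓ).eval z = ∑ n ∈ Finset.range (i + 1),
      (legendreP i).coeff n * (z ^ n * (legendreP ℓ).eval z) := by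
    intro z
    rw [Polynomial.eval_eq_sum_range' (Nat.lt_succ_of_le (natDegree_legendreP_le i)),
      Finset.sum_mul]
    simp only [mul_assoc]
  simp_rw [legendreCoeff, this]
  rw [intervalIntegral.integral_finsetSum, Finset.mul_sum]
  · refine Finset.sum_eq_zero fun n hn => ?_
    have h0 := legendreCoeff_pow_eq_zero (n := n) (ℓ := ℓ) (by have := Finset.mem_range.1 hn; omega)
    rw [legendreCoeff] at h0
    rw [intervalIntegral.integral_const_mul, mul_left_comm, h0, mul_zero]
  · intro n _
    exact Continuous.intervalIntegrable (by fun_prop) _ _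

theorem legendreCoeff_legendreP (i ℓ : ℕ) :
    legendreCoeff (fun z => (legendreP i).eval z) ℓ
      = if i = ℓ then 4 * Real.pi / (2 * ℓ + 1) else 0 := by
  split_ifs with h
  · subst h
    rw [legendreCoeff_eval, ← integral_sq_legendreP]
    simp_rw [pow_two]
  · rcases lt_or_gt_of_ne h with h | h
    · exact legendreCoeff_legendreP_of_lt h
    · have := legendreCoeff_legendreP_of_lt h
      rw [legendreCoeff_eval] at this ⊢
      simp_rw [mul_comm ((legendreP i).eval _)]
      exact this

/-- The normalization factor of the real spherical harmonics. -/
def sphNorm (ℓ : ℕ) (m : ℤ) : ℝ :=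
  if m = 0 then Real.sqrt ((2 * ℓ + 1) / (4 * Real.pi))
  else Real.sqrt ((2 * ℓ + 1) / (2 * Real.pi) *
    (((ℓ - m.natAbs).factorial : ℝ) / ((ℓ + m.natAbs).factorial : ℝ)))

theorem sphHarm_of_nonneg (ℓ : ℕ) {m : ℤ} (hm : 0 ≤ m) (x : S2) :
    sphHarm ℓ m x = sphNorm ℓ m * (assocHarm ℓ m.natAbs x).re := by
  rcases hm.eq_or_lt with rfl | h
  · simp [sphHarm, sphNorm, assocHarm]
  · simp only [sphHarm, sphNorm, if_neg h.ne', if_pos h, assocHarm, planar, Complex.re_mul_ofReal]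
    ring

theorem sphHarm_of_neg (ℓ : ℕ) {m : ℤ} (hm : m < 0) (x : S2) :
    sphHarm ℓ m x = sphNorm ℓ m * (assocHarm ℓ m.natAbs x).im := by
  simp only [sphHarm, sphNorm, if_neg hm.ne, if_neg hm.not_gt, assocHarm, planar,
    Complex.im_mul_ofReal]
  ring

theorem continuous_sphHarm (ℓ : ℕ) (m : ℤ) : Continuous (sphHarm ℓ m) := by
  have hc := continuous_assocHarm ℓ m.natAbs
  rcases lt_or_ge m 0 with h | h
  · rw [funext (sphHarm_of_neg ℓ h)]; exact continuous_const.mul (Complex.continuous_im.comp hc)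
  · rw [funext (sphHarm_of_nonneg ℓ h)]; exact continuous_const.mul (Complex.continuous_re.comp hc)

theorem integral_sphHarm_sq (ℓ : ℕ) (m : ℤ) (hm : m.natAbs ≤ ℓ) :
    ∫ x, sphHarm ℓ m x ^ 2 ∂sphereMeasure = 1 := by
  have hpi := Real.pi_pos
  have hc := continuous_assocHarm ℓ m.natAbs
  have h1 := integral_normSq_assocHarm hm
  by_cases h0 : m = 0
  · subst h0
    simp only [sphHarm_of_nonneg ℓ le_rfl, mul_pow, Int.natAbs_zero, assocHarm_zero,
      Complex.ofReal_re]
    rw [integral_const_mul, integral_sq_legendreP, sphNorm, if_pos rfl,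
      Real.sq_sqrt (by positivity)]
    field_simp
  have h2 := integral_sq_assocHarm (ℓ := ℓ) (k := m.natAbs) (by omega)
  have h2' := congrArg Complex.re h2
  rw [← RCLike.re_eq_complex_re, ← integral_re (integrable_of_continuous
    (f := fun x => assocHarm ℓ m.natAbs x ^ 2) (hc.pow 2))] at h2'
  have i1 : Integrable (fun x => (assocHarm ℓ m.natAbs x).re ^ 2) sphereMeasure :=
    integrable_of_continuous ((Complex.continuous_re.comp hc).pow 2)
  have i2 : Integrable (fun x => (assocHarm ℓ m.natAbs x).im ^ 2) sphereMeasure :=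
    integrable_of_continuous ((Complex.continuous_im.comp hc).pow 2)
  have e1 : ∫ x, (assocHarm ℓ m.natAbs x).re ^ 2 ∂sphereMeasure
      + ∫ x, (assocHarm ℓ m.natAbs x).im ^ 2 ∂sphereMeasure
      = 4 * Real.pi / (2 * ℓ + 1) * ((ℓ + m.natAbs).factorial / (ℓ - m.natAbs).factorial) := by
    rw [← h1, ← integral_add i1 i2]
    refine integral_congr_ae (.of_forall fun x => ?_)
    simp only [Complex.normSq_apply]; ring
  have e2 : ∫ x, (assocHarm ℓ m.natAbs x).re ^ 2 ∂sphereMeasure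
      - ∫ x, (assocHarm ℓ m.natAbs x).im ^ 2 ∂sphereMeasure = 0 := by
    rw [← integral_sub i1 i2]
    refine Eq.trans (integral_congr_ae (.of_forall fun x => ?_)) h2'
    simp [pow_two]
  have hf1 : ((ℓ + m.natAbs).factorial : ℝ) ≠ 0 := by exact_mod_cast Nat.factorial_ne_zero _
  have hf2 : ((ℓ - m.natAbs).factorial : ℝ) ≠ 0 := by exact_mod_cast Nat.factorial_ne_zero _
  have hN : sphNorm ℓ m ^ 2 * (4 * Real.pi / (2 * ℓ + 1) *
      ((ℓ + m.natAbs).factorial / (ℓ - m.natAbs).factorial)) = 2 := by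
    rw [sphNorm, if_neg h0, Real.sq_sqrt (by positivity)]
    field_simp
    norm_num
  rcases lt_or_ge m 0 with h | h
  · simp only [sphHarm_of_neg ℓ h, mul_pow]
    rw [integral_const_mul]
    linear_combination (1 / 2) * hN + sphNorm ℓ m ^ 2 / 2 * (e1 - e2)
  · simp only [sphHarm_of_nonneg ℓ h, mul_pow]
    rw [integral_const_mul]
    linear_combination (1 / 2) * hN + sphNorm ℓ m ^ 2 / 2 * (e1 + e2)

/-- Funk–Hecke formula for a polynomial kernel and real harmonics. -/
theorem integral_eval_mul_sphHarm (q : ℝ[X]) (ℓ : ℕ) (m : ℤ) (y : S2) :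
    ∫ x, q.eval (inner ℝ (x : E3) (y : E3)) * sphHarm ℓ m x ∂sphereMeasure
      = legendreCoeff (fun z => q.eval z) ℓ * sphHarm ℓ m y := by
  have hc := continuous_assocHarm ℓ m.natAbs
  have h := integral_eval_mul_assocHarm q ℓ m.natAbs y
  have hi : Integrable (fun x : S2 => ((q.eval (inner ℝ (x : E3) (y : E3)) : ℝ) : ℂ)
      * assocHarm ℓ m.natAbs x) sphereMeasure :=
    integrable_of_continuous ((Complex.continuous_ofReal.comp
        (q.continuous.comp (by fun_prop))).mul hc)
  rcases lt_or_ge m 0 with hm | hm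
  · simp only [sphHarm_of_neg ℓ hm, mul_left_comm _ (sphNorm ℓ m)]
    rw [integral_const_mul]
    congr 1
    have := congrArg Complex.im h
    rw [← RCLike.im_eq_complex_im, ← integral_im hi] at this
    simpa using this
  · simp only [sphHarm_of_nonneg ℓ hm, mul_left_comm _ (sphNorm ℓ m)]
    rw [integral_const_mul]
    congr 1
    have := congrArg Complex.re h
    rw [← RCLike.re_eq_complex_re, ← integral_re hi] at this
    simpa using this

theorem continuous_kernel {k : ℝ → ℝ} (hk : ContinuousOn k (Set.Icc (-1) 1)) :
    Continuous fun q : S2 × S2 => k (inner ℝ (q.1 : E3) (q.2 : E3)) :=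
  hk.comp_continuous (by fun_prop) fun q => inner_mem_Icc q.1 q.2

/-- **Funk–Hecke formula** for a continuous kernel, by Weierstrass approximation. -/
theorem integral_kernel_mul_sphHarm {k : ℝ → ℝ} (hk : ContinuousOn k (Set.Icc (-1) 1))
    (ℓ : ℕ) (m : ℤ) (y : S2) :
    ∫ x, k (inner ℝ (x : E3) (y : E3)) * sphHarm ℓ m x ∂sphereMeasure
      = legendreCoeff k ℓ * sphHarm ℓ m y := by
  have hY := continuous_sphHarm ℓ m
  set A := ∫ x, |sphHarm ℓ m x| ∂sphereMeasure
  set B := 4 * Real.pi * |sphHarm ℓ m y|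
  have hA : 0 ≤ A := integral_nonneg fun x => abs_nonneg _
  have hB : 0 ≤ B := by have := Real.pi_pos; positivity
  refine eq_of_abs_sub_le_all fun ε hε => ?_
  obtain ⟨q, hq⟩ := exists_polynomial_near_of_continuousOn (-1) 1 k hk (ε / (A + B + 1))
    (by positivity)
  set δ := ε / (A + B + 1) with hδ
  have h1 : |∫ x, k (inner ℝ (x : E3) (y : E3)) * sphHarm ℓ m x ∂sphereMeasure
      - ∫ x, q.eval (inner ℝ (x : E3) (y : E3)) * sphHarm ℓ m x ∂sphereMeasure| ≤ δ * A := by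
    rw [← integral_sub, ← integral_const_mul, ← Real.norm_eq_abs]
    · refine norm_integral_le_of_norm_le
        (integrable_of_continuous (by fun_prop)) (.of_forall fun x => ?_)
      rw [← sub_mul, norm_mul, Real.norm_eq_abs, Real.norm_eq_abs]
      refine mul_le_mul_of_nonneg_right ?_ (abs_nonneg _)
      rw [abs_sub_comm]
      exact (hq _ (inner_mem_Icc x y)).le
    · exact integrable_of_continuous (((continuous_kernel hk).comp
        (by fun_prop : Continuous fun x : S2 => (x, y))).mul hY)
    · exact integrable_of_continuous ((q.continuous.comp (by fun_prop)).mul hY)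
  have h2 : |legendreCoeff (fun z => q.eval z) ℓ - legendreCoeff k ℓ| ≤ δ * (4 * Real.pi) := by
    have hu : Set.uIcc (-1 : ℝ) 1 = Set.Icc (-1) 1 := Set.uIcc_of_le (by norm_num)
    rw [legendreCoeff, legendreCoeff, ← mul_sub, ← intervalIntegral.integral_sub, abs_mul,
      abs_of_pos (by have := Real.pi_pos; positivity)]
    · have := intervalIntegral.norm_integral_le_of_norm_le_const (a := (-1 : ℝ)) (b := 1) (C := δ)
        (f := fun z => q.eval z * (legendreP ℓ).eval z - k z * (legendreP ℓ).eval z) (by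
          intro z hz
          rw [Set.uIoc_of_le (by norm_num)] at hz
          have hz' : z ∈ Set.Icc (-1 : ℝ) 1 := Set.Ioc_subset_Icc_self hz
          rw [← sub_mul, norm_mul]
          have e1 := abs_eval_legendreP_le hz' ℓ
          have e2 := (hq z hz').le
          calc _ ≤ δ * 1 := mul_le_mul e2 e1 (abs_nonneg _) ((abs_nonneg _).trans e2)
            _ = δ := mul_one _)
      rw [Real.norm_eq_abs] at this
      have hpi := Real.pi_pos
      norm_num at this
      nlinarith
    · exact (q.continuous.mul (legendreP ℓ).continuous).intervalIntegrable _ _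
    · refine ContinuousOn.intervalIntegrable ?_
      rw [hu]
      exact hk.mul (legendreP ℓ).continuous.continuousOn
  rw [integral_eval_mul_sphHarm] at h1
  calc |∫ x, k (inner ℝ (x : E3) (y : E3)) * sphHarm ℓ m x ∂sphereMeasure
        - legendreCoeff k ℓ * sphHarm ℓ m y|
      ≤ |∫ x, k (inner ℝ (x : E3) (y : E3)) * sphHarm ℓ m x ∂sphereMeasure
          - legendreCoeff (fun z => q.eval z) ℓ * sphHarm ℓ m y|
        + |legendreCoeff (fun z => q.eval z) ℓ * sphHarm ℓ m y
          - legendreCoeff k ℓ * sphHarm ℓ m y| := abs_sub_le _ _ _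
    _ ≤ δ * A + δ * B := by
        refine add_le_add h1 ?_
        rw [← sub_mul, abs_mul]
        have := mul_le_mul_of_nonneg_right h2 (abs_nonneg (sphHarm ℓ m y))
        linarith
    _ ≤ ε := by
        rw [← mul_add, hδ, div_mul_eq_mul_div, div_le_iff₀ (by positivity)]
        nlinarith

/-! ### Concentration of empirical autocovariances of Gaussian sequences -/

section

theorem gaussianPDFReal_mul_exp_sq (c x : ℝ) :
    gaussianPDFReal 0 1 x * Real.exp (c * x ^ 2)
      = (Real.sqrt (2 * Real.pi))⁻¹ * Real.exp (-(1 / 2 - c) * x ^ 2) := by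
  rw [gaussianPDFReal, mul_assoc, ← Real.exp_add]
  simp only [NNReal.coe_one, mul_one, sub_zero]
  congr 2
  ring

theorem integrable_exp_mul_sq_gaussianReal {c : ℝ} (hc : c < 1 / 2) :
    Integrable (fun x => Real.exp (c * x ^ 2)) (gaussianReal 0 1) := by
  rw [gaussianReal_of_var_ne_zero 0 one_ne_zero, integrable_withDensity_iff
    (measurable_gaussianPDF 0 1) (.of_forall fun _ => gaussianPDF_lt_top)]
  simp only [toReal_gaussianPDF]
  simp_rw [mul_comm, gaussianPDFReal_mul_exp_sq]
  exact (integrable_exp_neg_mul_sq (by linarith)).const_mul _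

theorem integral_exp_mul_sq_gaussianReal {c : ℝ} (hc : c < 1 / 2) :
    ∫ x, Real.exp (c * x ^ 2) ∂(gaussianReal 0 1) = (Real.sqrt (1 - 2 * c))⁻¹ := by
  rw [integral_gaussianReal_eq_integral_smul one_ne_zero]
  simp_rw [smul_eq_mul, gaussianPDFReal_mul_exp_sq]
  have hpi := Real.pi_pos
  rw [integral_const_mul, integral_gaussian, ← Real.sqrt_inv, ← Real.sqrt_mul (by positivity),
    ← Real.sqrt_inv]
  congr 1
  have h1 : 1 / 2 - c ≠ 0 := by linarith
  have h2 : 1 - 2 * c ≠ 0 := by linarith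
  field_simp

theorem inv_sqrt_one_add_le {s : ℝ} (hs : 0 ≤ s) :
    (Real.sqrt (1 + 2 * s))⁻¹ ≤ Real.exp (2 * s ^ 2 - s) := by
  rw [inv_le_iff_one_le_mul₀ (Real.sqrt_pos.2 (by linarith)), ← abs_of_pos (Real.exp_pos _),
    ← Real.sqrt_sq_eq_abs, ← Real.sqrt_mul (sq_nonneg _), Real.one_le_sqrt, pow_two, ← Real.exp_add]
  have h := Real.add_one_le_exp (2 * s ^ 2 - s + (2 * s ^ 2 - s))
  have h2 := mul_le_mul_of_nonneg_right h (by linarith : 0 ≤ 1 + 2 * s)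
  refine le_trans ?_ h2
  nlinarith [pow_nonneg hs 3]

theorem inv_sqrt_one_sub_le {u : ℝ} (hu : 0 ≤ u) (hu2 : u ≤ 1 / 4) :
    (Real.sqrt (1 - u))⁻¹ ≤ Real.exp u := by
  rw [inv_le_iff_one_le_mul₀ (Real.sqrt_pos.2 (by linarith)), ← abs_of_pos (Real.exp_pos _),
    ← Real.sqrt_sq_eq_abs, ← Real.sqrt_mul (sq_nonneg _), Real.one_le_sqrt, pow_two, ← Real.exp_add]
  have h := Real.add_one_le_exp (u + u)
  have h2 := mul_le_mul_of_nonneg_right h (by linarith : 0 ≤ 1 - u)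
  refine le_trans ?_ h2
  nlinarith

variable {Ω : Type*} [MeasurableSpace Ω] {μ : Measure Ω}

theorem integral_exp_mul_mul_gaussianReal (s x : ℝ) :
    ∫ y, Real.exp (s * (x * y)) ∂(gaussianReal 0 1) = Real.exp (s ^ 2 / 2 * x ^ 2) := by
  have := mgf_gaussianReal (p := gaussianReal 0 1) (X := id) (μ := 0) (v := 1) (by simp) (s * x)
  simp only [mgf, id, NNReal.coe_one] at this
  simp_rw [← mul_assoc]
  rw [this]
  congr 1; ring

theorem integrable_exp_mul_prod_gaussianReal {s : ℝ} (hs : s ^ 2 ≤ 1 / 4) :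
    Integrable (fun q : ℝ × ℝ => Real.exp (s * (q.1 * q.2)))
      ((gaussianReal 0 1).prod (gaussianReal 0 1)) := by
  rw [integrable_prod_iff (by fun_prop)]
  refine ⟨.of_forall fun x => ?_, ?_⟩
  · have := integrable_exp_mul_gaussianReal (μ := 0) (v := 1) (s * x)
    simpa [mul_assoc] using this
  · simp only [Real.norm_eq_abs, Real.abs_exp, integral_exp_mul_mul_gaussianReal]
    exact integrable_exp_mul_sq_gaussianReal (by linarith)

/-- The moment generating function of a product of independent standard Gaussian variables is
`(1 - s²)^{-1/2}`. -/
theorem mgf_mul_le [IsProbabilityMeasure μ] {X Y : Ω → ℝ} (hX : Measurable X) (hY : Measurable Y)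
    (lX : μ.map X = gaussianReal 0 1) (lY : μ.map Y = gaussianReal 0 1) (hXY : IndepFun X Y μ)
    {s : ℝ} (hs : s ^ 2 ≤ 1 / 4) :
    Integrable (fun ω => Real.exp (s * (X ω * Y ω))) μ ∧
      mgf (fun ω => X ω * Y ω) μ s ≤ Real.exp (s ^ 2) := by
  have hm := (indepFun_iff_map_prod_eq_prod_map_map hX.aemeasurable hY.aemeasurable).1 hXY
  rw [lX, lY] at hm
  have hi := integrable_exp_mul_prod_gaussianReal hs
  rw [← hm] at hi
  refine ⟨hi.comp_measurable (hX.prodMk hY), ?_⟩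
  have e : mgf (fun ω => X ω * Y ω) μ s
      = ∫ q : ℝ × ℝ, Real.exp (s * (q.1 * q.2)) ∂(μ.map fun ω => (X ω, Y ω)) := by
    rw [integral_map (hX.prodMk hY).aemeasurable (by fun_prop)]
    rfl
  rw [e, hm, integral_prod _ (integrable_exp_mul_prod_gaussianReal hs)]
  simp only [integral_exp_mul_mul_gaussianReal]
  rw [integral_exp_mul_sq_gaussianReal (by linarith)]
  have := inv_sqrt_one_sub_le (sq_nonneg s) hs
  rwa [show 2 * (s ^ 2 / 2) = s ^ 2 by ring]

/-- `x` is a sequence of independent standard Gaussian variables. -/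
structure IsStdGaussianSeq (x : ℤ → Ω → ℝ) (μ : Measure Ω) : Prop where
  measurable : ∀ t, Measurable (x t)
  law : ∀ t, μ.map (x t) = gaussianReal 0 1
  indep : iIndepFun x μ

/-- Lower deviation of the empirical variance. The Chernoff bound is used at `-s` with `s = δ / 4`,
which optimizes the bound `exp (2 s² - s)` for the moment generating function of a square. -/
theorem IsStdGaussianSeq.measure_sum_sq_le [IsProbabilityMeasure μ] {x : ℤ → Ω → ℝ}
    (hx : IsStdGaussianSeq x μ) (I : Finset ℤ) (a : ℤ) {δ : ℝ} (hδ : 0 ≤ δ) :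
    μ.real {ω | ∑ t ∈ I, x (t - a) ω * x (t - a) ω ≤ I.card * (1 - δ)}
      ≤ Real.exp (-(I.card * δ ^ 2 / 8)) := by
  set s := δ / 4 with hs
  have hs0 : 0 ≤ s := by positivity
  have hind : iIndepFun (fun t ω => x (t - a) ω * x (t - a) ω) μ :=
    (hx.indep.precomp (sub_left_injective (b := a))).comp (fun _ y => y * y)
      (fun _ => by fun_prop)
  have hm : ∀ t, Measurable fun ω => x (t - a) ω * x (t - a) ω := fun t =>
    (hx.measurable _).mul (hx.measurable _)
  have hint : ∀ t, Integrable (fun ω => Real.exp (-s * (x (t - a) ω * x (t - a) ω))) μ := by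
    intro t
    have := integrable_exp_mul_sq_gaussianReal (c := -s) (by linarith)
    rw [← hx.law (t - a)] at this
    simpa [pow_two, Function.comp_def] using this.comp_measurable (hx.measurable _)
  have hmgf : ∀ t, mgf (fun ω => x (t - a) ω * x (t - a) ω) μ (-s) ≤ Real.exp (2 * s ^ 2 - s) := by
    intro t
    have := integral_exp_mul_sq_gaussianReal (c := -s) (by linarith)
    rw [← hx.law (t - a), integral_map (hx.measurable _).aemeasurable (by fun_prop)] at this
    simp only [mgf, ← pow_two]
    rw [this, show 1 - 2 * -s = 1 + 2 * s by ring]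
    exact inv_sqrt_one_add_le hs0
  have h := measure_le_le_exp_mul_mgf (μ := μ) (t := -s)
    (X := ∑ t ∈ I, fun ω => x (t - a) ω * x (t - a) ω) (I.card * (1 - δ)) (by linarith)
    (hind.integrable_exp_mul_sum hm fun t _ => hint t)
  rw [hind.mgf_sum hm] at h
  have hp : ∏ t ∈ I, mgf (fun ω => x (t - a) ω * x (t - a) ω) μ (-s)
      ≤ Real.exp (I.card * (2 * s ^ 2 - s)) := by
    rw [Real.exp_nat_mul, ← Finset.prod_const]
    exact Finset.prod_le_prod (fun t _ => mgf_nonneg) fun t _ => hmgf t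
  simp only [Finset.sum_apply] at h
  refine h.trans ((mul_le_mul_of_nonneg_left hp (Real.exp_pos _).le).trans ?_)
  rw [← Real.exp_add, Real.exp_le_exp, hs]
  apply le_of_eq
  ring

/-- The moment generating function of a sum of products over pairwise disjoint pairs of indices. -/
theorem IsStdGaussianSeq.mgf_sum_mul_le [IsProbabilityMeasure μ] {x : ℤ → Ω → ℝ}
    (hx : IsStdGaussianSeq x μ) {a b : ℤ} (hab : a ≠ b) {u : ℝ} (hu : u ^ 2 ≤ 1 / 4)
    (A : Finset ℤ) (hA : ∀ t ∈ A, ∀ t' ∈ A, t - a ≠ t' - b) :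
    Integrable (fun ω => Real.exp (u * (∑ t ∈ A, x (t - a) ω * x (t - b) ω))) μ ∧
      mgf (fun ω => ∑ t ∈ A, x (t - a) ω * x (t - b) ω) μ u ≤ Real.exp (A.card * u ^ 2) := by
  classical
  induction A using Finset.induction_on with
  | empty => simp
  | insert t A ht ih =>
    obtain ⟨ih1, ih2⟩ := ih fun s hs s' hs' =>
      hA s (Finset.mem_insert_of_mem hs) s' (Finset.mem_insert_of_mem hs')
    obtain ⟨h1, h2⟩ := mgf_mul_le (hx.measurable (t - a)) (hx.measurable (t - b)) (hx.law _)
      (hx.law _) (hx.indep.indepFun (by omega)) hu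
    set S : Finset ℤ := A.image (· - a) ∪ A.image (· - b) with hS
    set S' : Finset ℤ := {t - a, t - b} with hS'
    have hdisj : Disjoint S' S := by
      rw [Finset.disjoint_left]
      intro r hr hr'
      simp only [hS, hS', Finset.mem_insert, Finset.mem_singleton, Finset.mem_union,
        Finset.mem_image] at hr hr'
      have key : ∀ s ∈ A, s ≠ t ∧ t - a ≠ s - b ∧ s - a ≠ t - b := fun s hs =>
        ⟨fun h => ht (h ▸ hs), hA t (Finset.mem_insert_self _ _) s (Finset.mem_insert_of_mem hs),
          hA s (Finset.mem_insert_of_mem hs) t (Finset.mem_insert_self _ _)⟩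
      rcases hr' with ⟨s, hs, hr'⟩ | ⟨s, hs, hr'⟩ <;> have := key s hs <;> omega
    have hind : IndepFun (fun ω => x (t - a) ω * x (t - b) ω)
        (fun ω => ∑ s ∈ A, x (s - a) ω * x (s - b) ω) μ := by
      let φ : (S' → ℝ) → ℝ := fun g => g ⟨t - a, by simp [hS']⟩ * g ⟨t - b, by simp [hS']⟩
      let ψ : (S → ℝ) → ℝ := fun g => ∑ s : A,
        g ⟨s - a, Finset.mem_union_left _ (Finset.mem_image_of_mem _ s.2)⟩ *
          g ⟨s - b, Finset.mem_union_right _ (Finset.mem_image_of_mem _ s.2)⟩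
      have h := (hx.indep.indepFun_finset S' S hdisj hx.measurable).comp
        (φ := φ) (ψ := ψ) (by fun_prop) (by fun_prop)
      have e : (fun ω => ∑ s ∈ A, x (s - a) ω * x (s - b) ω) = ψ ∘ fun ω (i : S) => x i ω := by
        ext ω
        exact (Finset.sum_coe_sort A fun s => x (s - a) ω * x (s - b) ω).symm
      rw [e]
      exact h
    simp only [Finset.sum_insert ht]
    refine ⟨hind.integrable_exp_mul_add h1 ih1, ?_⟩
    have e := hind.mgf_add h1.aestronglyMeasurable ih1.aestronglyMeasurable
    rw [Finset.card_insert_of_notMem ht]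
    refine (le_of_eq e).trans ((mul_le_mul h2 ih2 mgf_nonneg (Real.exp_pos _).le).trans ?_)
    rw [← Real.exp_add]
    push_cast
    apply le_of_eq; congr 1; ring

/-- Deviation of a sum of products over pairwise disjoint pairs of indices. -/
theorem IsStdGaussianSeq.measure_abs_sum_mul_ge_of_disjoint [IsProbabilityMeasure μ] {x : ℤ → Ω → ℝ}
    (hx : IsStdGaussianSeq x μ) (A : Finset ℤ) {a b : ℤ} (hab : a ≠ b)
    (hA : ∀ t ∈ A, ∀ t' ∈ A, t - a ≠ t' - b) {r s : ℝ} (hs : 0 ≤ s) (hs2 : s ^ 2 ≤ 1 / 4) :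
    μ.real {ω | r ≤ |∑ t ∈ A, x (t - a) ω * x (t - b) ω|}
      ≤ 2 * Real.exp (A.card * s ^ 2 - s * r) := by
  have hs3 : (-s) ^ 2 ≤ 1 / 4 := by rwa [neg_sq]
  obtain ⟨i1, m1⟩ := hx.mgf_sum_mul_le hab hs2 A hA
  obtain ⟨i2, m2⟩ := hx.mgf_sum_mul_le hab hs3 A hA
  have h1 := measure_ge_le_exp_mul_mgf r hs i1
  have h2 := measure_le_le_exp_mul_mgf (-r) (neg_nonpos.2 hs) i2
  have hsub : {ω | r ≤ |∑ t ∈ A, x (t - a) ω * x (t - b) ω|}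
      ⊆ {ω | r ≤ ∑ t ∈ A, x (t - a) ω * x (t - b) ω} ∪
        {ω | ∑ t ∈ A, x (t - a) ω * x (t - b) ω ≤ -r} := by
    intro ω hω
    simp only [Set.mem_ofPred_eq, Set.mem_union] at hω ⊢
    rcases le_abs.1 hω with h | h
    · exact Or.inl h
    · exact Or.inr (by linarith)
  have hb1 := mul_le_mul_of_nonneg_left m1 (Real.exp_pos (-s * r)).le
  have hb2 := mul_le_mul_of_nonneg_left m2 (Real.exp_pos (- -s * -r)).le
  rw [← Real.exp_add] at hb1 hb2
  rw [show -s * r + A.card * s ^ 2 = A.card * s ^ 2 - s * r by ring] at hb1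
  rw [show - -s * -r + A.card * (-s) ^ 2 = A.card * s ^ 2 - s * r by ring] at hb2
  calc _ ≤ _ := measureReal_mono hsub
    _ ≤ _ := measureReal_union_le _ _
    _ ≤ _ := by linarith

/-- Deviation of the empirical autocovariance at a non-zero lag. Splitting the times by the parity
of `⌊(t - a) / (a - b)⌋` leaves two sums over disjoint pairs of indices. -/
theorem IsStdGaussianSeq.measure_abs_sum_mul_ge [IsProbabilityMeasure μ] {x : ℤ → Ω → ℝ}
    (hx : IsStdGaussianSeq x μ) (I : Finset ℤ) {a b : ℤ} (hab : a ≠ b) {δ : ℝ} (hδ : 0 ≤ δ)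
    (hδ1 : δ ≤ 1) :
    μ.real {ω | I.card * δ ≤ |∑ t ∈ I, x (t - a) ω * x (t - b) ω|}
      ≤ 4 * Real.exp (-(I.card * δ ^ 2 / 16)) := by
  classical
  wlog hlt : b < a generalizing a b
  · have := this hab.symm (by omega)
    simp_rw [mul_comm (x (_ - b) _)] at this
    exact this
  set h := a - b with hh
  have key : ∀ c : ℤ, μ.real {ω | I.card * δ / 2 ≤
      |∑ t ∈ I with (t - a) / h % 2 = c, x (t - a) ω * x (t - b) ω|}
      ≤ 2 * Real.exp (-(I.card * δ ^ 2 / 16)) := by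
    intro c
    refine (hx.measure_abs_sum_mul_ge_of_disjoint (I.filter fun t => (t - a) / h % 2 = c) hab ?_
      (r := I.card * δ / 2) (s := δ / 4) (by positivity) (by nlinarith)).trans ?_
    · intro t ht t' ht' heq
      have h1 := (Finset.mem_filter.1 ht).2
      have h2 := (Finset.mem_filter.1 ht').2
      rw [show t - a = (t' - a) + 1 * h by rw [hh]; omega,
        Int.add_mul_ediv_right _ _ (by omega : h ≠ 0)] at h1
      omega
    · have hc : ((I.filter fun t => (t - a) / h % 2 = c).card : ℝ) ≤ I.card := by
        exact_mod_cast Finset.card_filter_le _ _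
      refine mul_le_mul_of_nonneg_left (Real.exp_le_exp.2 ?_) two_pos.le
      nlinarith [mul_le_mul_of_nonneg_right hc (sq_nonneg δ)]
  have hsub : {ω | I.card * δ ≤ |∑ t ∈ I, x (t - a) ω * x (t - b) ω|} ⊆
      {ω | I.card * δ / 2 ≤ |∑ t ∈ I with (t - a) / h % 2 = 0, x (t - a) ω * x (t - b) ω|} ∪
      {ω | I.card * δ / 2 ≤ |∑ t ∈ I with (t - a) / h % 2 = 1, x (t - a) ω * x (t - b) ω|} := by
    intro ω hω
    have e := Finset.sum_filter_add_sum_filter_not I (fun t => (t - a) / h % 2 = 0)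
      (fun t => x (t - a) ω * x (t - b) ω)
    have e2 : (I.filter fun t => ¬ (t - a) / h % 2 = 0) = I.filter fun t => (t - a) / h % 2 = 1 :=
      Finset.filter_congr fun t _ => by omega
    rw [e2] at e
    simp only [Set.mem_ofPred_eq, Set.mem_union, ← e] at hω ⊢
    by_contra! hcon
    have := abs_add_le (∑ t ∈ I with (t - a) / h % 2 = 0, x (t - a) ω * x (t - b) ω)
      (∑ t ∈ I with (t - a) / h % 2 = 1, x (t - a) ω * x (t - b) ω)
    linarith
  calc _ ≤ _ := measureReal_mono hsub
    _ ≤ _ := measureReal_union_le _ _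
    _ ≤ _ := by linarith [key 0, key 1]

end

/-! ### Deterministic lower bound for autoregressions -/

/-- Multiplication by a polynomial bounded on the unit circle, in the `ℓ²` norm of the
coefficients. -/
theorem sum_sq_coeff_mul_le (P Q : ℂ[X]) {M : ℝ} (hM : ∀ z : ℂ, ‖z‖ = 1 → ‖P.eval z‖ ^ 2 ≤ M)
    (s : Finset ℕ) :
    ∑ i ∈ s, ‖(P * Q).coeff i‖ ^ 2 ≤ M * ∑ i ∈ Q.support, ‖Q.coeff i‖ ^ 2 := by
  have h1 : ∑ i ∈ s, ‖(P * Q).coeff i‖ ^ 2 ≤ ∑ i ∈ (P * Q).support, ‖(P * Q).coeff i‖ ^ 2 := by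
    rw [← Finset.sum_inter_add_sum_sdiff s (P * Q).support]
    have h0 : ∑ i ∈ s \ (P * Q).support, ‖(P * Q).coeff i‖ ^ 2 = 0 :=
      Finset.sum_eq_zero fun i hi => by
        rw [Polynomial.notMem_support_iff.1 (Finset.mem_sdiff.1 hi).2]; simp
    rw [h0, add_zero]
    exact Finset.sum_le_sum_of_subset_of_nonneg Finset.inter_subset_right
      fun i _ _ => by positivity
  refine h1.trans ?_
  rw [Polynomial.sum_sq_norm_coeff_eq_circleAverage, Polynomial.sum_sq_norm_coeff_eq_circleAverage,
    ← smul_eq_mul (a := M), ← Real.circleAverage_fun_smul]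
  refine Real.circleAverage_mono ?_ ?_ ?_
  · exact ContinuousOn.circleIntegrable zero_le_one (by fun_prop)
  · exact ContinuousOn.circleIntegrable zero_le_one (by fun_prop)
  · intro z hz
    have hz1 : ‖z‖ = 1 := by simpa using hz
    simp only [Polynomial.eval_mul, norm_mul, mul_pow, smul_eq_mul]
    exact mul_le_mul_of_nonneg_right (hM z hz1) (by positivity)

/-- A linear recursion with forcing term `w`: by Parseval's identity for the sequence `y` cut off
outside a window, the forcing is controlled by `y` inside the window. -/
theorem sum_sq_forcing_le {p : ℕ} (φ : Fin p → ℝ) {M : ℝ}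
    (hM : ∀ z : ℂ, ‖z‖ = 1 → ‖1 - ∑ j : Fin p, (φ j : ℂ) * z ^ ((j : ℕ) + 1)‖ ^ 2 ≤ M)
    (y w : ℤ → ℝ) (hy : ∀ t, y t = ∑ j : Fin p, φ j * y (t - ((j : ℕ) + 1 : ℤ)) + w t)
    (a : ℤ) (N : ℕ) :
    ∑ i ∈ Finset.Ico p N, w (a + i) ^ 2 ≤ M * ∑ i ∈ Finset.range N, y (a + i) ^ 2 := by
  set Q : ℂ[X] := ∑ i ∈ Finset.range N, Polynomial.monomial i (y (a + i) : ℂ) with hQ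
  set P : ℂ[X] := 1 - ∑ j : Fin p, Polynomial.C (φ j : ℂ) * Polynomial.X ^ ((j : ℕ) + 1) with hP
  have hQc : ∀ i : ℕ, Q.coeff i = if i < N then (y (a + i) : ℂ) else 0 := by
    intro i
    simp only [hQ, Polynomial.finsetSum_coeff, Polynomial.coeff_monomial]
    rw [Finset.sum_ite_eq' (Finset.range N) i]
    simp
  have h := sum_sq_coeff_mul_le P Q (M := M) (fun z hz => by
    simpa [hP, Polynomial.eval_finsetSum] using hM z hz) (Finset.Ico p N)
  have e1 : ∀ i ∈ Finset.Ico p N, ‖(P * Q).coeff i‖ ^ 2 = w (a + i) ^ 2 := by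
    intro i hi
    obtain ⟨hi1, hi2⟩ := Finset.mem_Ico.1 hi
    have : (P * Q).coeff i = ((w (a + i) : ℝ) : ℂ) := by
      rw [hP, sub_mul, one_mul, Polynomial.coeff_sub, hQc, if_pos hi2, Finset.sum_mul,
        Polynomial.finsetSum_coeff]
      have h2 : ∀ j : Fin p, (Polynomial.C (φ j : ℂ) * Polynomial.X ^ ((j : ℕ) + 1) * Q).coeff i
          = ((φ j * y (a + i - ((j : ℕ) + 1 : ℤ)) : ℝ) : ℂ) := by
        intro j
        have hj := j.2
        rw [mul_assoc, Polynomial.coeff_C_mul, Polynomial.coeff_X_pow_mul', if_pos (by omega), hQc,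
          if_pos (by omega), Complex.ofReal_mul]
        congr 3
        push_cast [Nat.cast_sub (show (j : ℕ) + 1 ≤ i by omega)]
        ring
      simp_rw [h2]
      rw [hy (a + i)]
      push_cast
      ring
    rw [this, Complex.norm_real, Real.norm_eq_abs, sq_abs]
  rw [Finset.sum_congr rfl e1] at h
  have e2 : ∑ i ∈ Q.support, ‖Q.coeff i‖ ^ 2 = ∑ i ∈ Finset.range N, y (a + i) ^ 2 := by
    have hs : Q.support ⊆ Finset.range N := by
      intro i hi
      rw [Polynomial.mem_support_iff, hQc] at hi
      by_contra hn
      exact hi (if_neg (by simpa using hn))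
    have h0 : ∀ i ∈ Finset.range N, i ∉ Q.support → ‖Q.coeff i‖ ^ 2 = 0 := fun i _ hi => by
      rw [Polynomial.notMem_support_iff.1 hi]; simp
    rw [Finset.sum_subset hs h0]
    refine Finset.sum_congr rfl fun i hi => ?_
    rw [hQc, if_pos (Finset.mem_range.1 hi), Complex.norm_real, Real.norm_eq_abs, sq_abs]
  rwa [e2] at h

theorem sq_sum_abs_le {p : ℕ} (θ : Fin p → ℝ) : (∑ i, |θ i|) ^ 2 ≤ p * ∑ i, θ i ^ 2 := by
  have := sq_sum_le_card_mul_sum_sq (s := Finset.univ) (f := fun i => |θ i|)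
  simpa using this

/-- A matrix that is entrywise close to a multiple of the identity is bounded below. -/
theorem quadForm_ge {p : ℕ} (S : Fin p → Fin p → ℝ) {κ δ : ℝ} (hκ : 0 ≤ κ) (hδ : δ * p ≤ 1 / 4)
    (hδ0 : 0 ≤ δ)
    (hd : ∀ j, κ * (1 - δ) ≤ S j j) (ho : ∀ j k, j ≠ k → |S j k| ≤ κ * δ) (θ : Fin p → ℝ) :
    3 / 4 * κ * ∑ i, θ i ^ 2 ≤ ∑ j, ∑ k, θ j * θ k * S j k := by
  have h1 : ∀ j k, (if j = k then κ * θ j ^ 2 else 0) - κ * δ * (|θ j| * |θ k|)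
      ≤ θ j * θ k * S j k := by
    intro j k
    split_ifs with h
    · subst h
      have := mul_le_mul_of_nonneg_left (hd j) (sq_nonneg (θ j))
      rw [← abs_mul, abs_of_nonneg (mul_self_nonneg _)]
      nlinarith
    · have h2 := mul_le_mul_of_nonneg_left (ho j k h)
        (mul_nonneg (abs_nonneg (θ j)) (abs_nonneg (θ k)))
      have h3 := neg_abs_le (θ j * θ k * S j k)
      rw [abs_mul, abs_mul] at h3
      linarith
  have h2 : ∑ j, ∑ k, ((if j = k then κ * θ j ^ 2 else 0) - κ * δ * (|θ j| * |θ k|))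
      = κ * ∑ i, θ i ^ 2 - κ * δ * (∑ i, |θ i|) ^ 2 := by
    simp only [Finset.sum_sub_distrib, Finset.sum_ite_eq, Finset.mem_univ, if_true,
      ← Finset.mul_sum, ← Finset.sum_mul, pow_two (∑ i, |θ i|)]
  refine le_trans ?_ (Finset.sum_le_sum fun j _ => Finset.sum_le_sum fun k _ => h1 j k)
  rw [h2]
  have h3 := mul_le_mul_of_nonneg_left (sq_sum_abs_le θ) (mul_nonneg hκ hδ0)
  have h4 : 0 ≤ ∑ i, θ i ^ 2 := Finset.sum_nonneg fun i _ => sq_nonneg _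
  nlinarith [mul_le_mul_of_nonneg_right hδ (mul_nonneg hκ h4)]

theorem sum_sq_le_sq_sum_abs {p : ℕ} (θ : Fin p → ℝ) : ∑ i, θ i ^ 2 ≤ (∑ i, |θ i|) ^ 2 := by
  have := Finset.sum_sq_le_sq_sum_of_nonneg (s := Finset.univ) (f := fun i => |θ i|)
    (fun i _ => abs_nonneg _)
  simpa using this

/-- The deterministic lower bound: an autoregression driven by `z` has a Gram matrix of lagged
values bounded below once the sums of products of lagged values of `z` are entrywise within `κ δ` of
`κ` times the identity matrix. Here `M` bounds the square of the autoregressive filter on the unit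
circle. -/
theorem sum_sq_lagged_ge {p : ℕ} (φ : Fin p → ℝ) {M : ℝ}
    (hM : ∀ z : ℂ, ‖z‖ = 1 → ‖1 - ∑ j : Fin p, (φ j : ℂ) * z ^ ((j : ℕ) + 1)‖ ^ 2 ≤ M)
    (a z : ℤ → ℝ) (ha : ∀ t, a t = ∑ j : Fin p, φ j * a (t - ((j : ℕ) + 1 : ℤ)) + z t)
    (N : ℕ) {κ δ : ℝ} (hκ : 0 ≤ κ) (hδ : δ * p ≤ 1 / 4) (hδ0 : 0 ≤ δ)
    (hd : ∀ j : Fin p, κ * (1 - δ) ≤ ∑ i ∈ Finset.Ico p N,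
      z (p + 1 + i - ((j : ℕ) + 1 : ℤ)) * z (p + 1 + i - ((j : ℕ) + 1 : ℤ)))
    (ho : ∀ j k : Fin p, j ≠ k → |∑ i ∈ Finset.Ico p N,
      z (p + 1 + i - ((j : ℕ) + 1 : ℤ)) * z (p + 1 + i - ((k : ℕ) + 1 : ℤ))| ≤ κ * δ)
    (θ : Fin p → ℝ) :
    3 / 4 * κ * ∑ i, θ i ^ 2 ≤
      M * ∑ i ∈ Finset.range N, (∑ j : Fin p, θ j * a (p + 1 + i - ((j : ℕ) + 1 : ℤ))) ^ 2 := by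
  refine (quadForm_ge _ hκ hδ hδ0 hd ho θ).trans ?_
  refine le_trans (le_of_eq (Eq.symm ?_)) (sum_sq_forcing_le φ hM
    (fun t => ∑ j : Fin p, θ j * a (t - ((j : ℕ) + 1 : ℤ)))
    (fun t => ∑ j : Fin p, θ j * z (t - ((j : ℕ) + 1 : ℤ))) (fun t => ?_) (p + 1) N)
  · simp only [pow_two, Finset.sum_mul_sum]
    rw [Finset.sum_comm]
    refine Finset.sum_congr rfl fun j _ => ?_
    rw [Finset.sum_comm]
    refine Finset.sum_congr rfl fun k _ => ?_
    rw [Finset.mul_sum]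
    refine Finset.sum_congr rfl fun i _ => ?_
    ring
  · simp only [Finset.mul_sum]
    rw [Finset.sum_comm, ← Finset.sum_add_distrib]
    refine Finset.sum_congr rfl fun j _ => ?_
    rw [ha (t - ((j : ℕ) + 1 : ℤ)), mul_add, Finset.mul_sum]
    congr 1
    refine Finset.sum_congr rfl fun k _ => ?_
    rw [sub_right_comm]; ring

/-! ### Integrals of Gaussian fields -/

section GaussianIntegral

variable {Ω : Type*} [MeasurableSpace Ω] {μ : Measure Ω}
  {S : Type*} [MeasurableSpace S] {σ : Measure S} [IsFiniteMeasure σ]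
  {Z : S → Ω → ℝ} {Y : S → ℝ} {K B : ℝ}

/-- A jointly measurable field whose second moments exist and are bounded by `K`. -/
structure IsBoundedL2 (Z : S → Ω → ℝ) (μ : Measure Ω) (K : ℝ) : Prop where
  measurable : Measurable fun q : S × Ω => Z q.1 q.2
  memLp : ∀ x, MemLp (Z x) 2 μ
  bound : ∀ x, ∫ ω, Z x ω ^ 2 ∂μ ≤ K

theorem IsBoundedL2.integral_abs_mul_le (hZ : IsBoundedL2 Z μ K) (x y : S) :
    ∫ ω, |Z x ω * Z y ω| ∂μ ≤ K := by
  have h1 := (hZ.memLp x).integrable_sq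
  have h2 := (hZ.memLp y).integrable_sq
  have h3 : ∫ ω, |Z x ω * Z y ω| ∂μ ≤ ∫ ω, (1 / 2 * Z x ω ^ 2 + 1 / 2 * Z y ω ^ 2) ∂μ := by
    refine integral_mono ((hZ.memLp x).integrable_mul (hZ.memLp y)).abs
      ((h1.const_mul _).add (h2.const_mul _)) fun ω => ?_
    simp only [abs_mul]
    nlinarith [sq_nonneg (|Z x ω| - |Z y ω|), sq_abs (Z x ω), sq_abs (Z y ω)]
  rw [integral_add (h1.const_mul _) (h2.const_mul _), integral_const_mul, integral_const_mul] at h3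
  linarith [hZ.bound x, hZ.bound y]

theorem IsBoundedL2.memLp_prod [IsProbabilityMeasure μ] (hZ : IsBoundedL2 Z μ K) :
    MemLp (fun q : S × Ω => Z q.1 q.2) 2 (σ.prod μ) := by
  rw [memLp_two_iff_integrable_sq hZ.measurable.aestronglyMeasurable, integrable_prod_iff
    (hZ.measurable.pow_const 2).aestronglyMeasurable]
  refine ⟨.of_forall fun x => (hZ.memLp x).integrable_sq, ?_⟩
  refine Integrable.mono' (integrable_const K) ?_ (.of_forall fun x => ?_)
  · exact
      (hZ.measurable.pow_const 2).norm.stronglyMeasurable.integral_prod_right'.aestronglyMeasurable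
  · simp only [norm_pow, Real.norm_eq_abs, sq_abs]
    rw [abs_of_nonneg (integral_nonneg fun ω => sq_nonneg _)]
    exact hZ.bound x

theorem IsBoundedL2.integrable_pair [IsProbabilityMeasure μ] (hZ : IsBoundedL2 Z μ K)
    (hY : Measurable Y)
    (hB : ∀ x, |Y x| ≤ B) :
    Integrable (fun q : (S × S) × Ω => Z q.1.1 q.2 * Y q.1.1 * (Z q.1.2 q.2 * Y q.1.2))
      ((σ.prod σ).prod μ) := by
  have hm : Measurable fun q : (S × S) × Ω => Z q.1.1 q.2 * Y q.1.1 * (Z q.1.2 q.2 * Y q.1.2) := by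
    have h1 : Measurable fun q : (S × S) × Ω => Z q.1.1 q.2 :=
      hZ.measurable.comp (by fun_prop : Measurable fun q : (S × S) × Ω => (q.1.1, q.2))
    have h2 : Measurable fun q : (S × S) × Ω => Z q.1.2 q.2 :=
      hZ.measurable.comp (by fun_prop : Measurable fun q : (S × S) × Ω => (q.1.2, q.2))
    exact (h1.mul (hY.comp (by fun_prop))).mul (h2.mul (hY.comp (by fun_prop)))
  rw [integrable_prod_iff hm.aestronglyMeasurable]
  refine ⟨.of_forall fun q => ?_, ?_⟩
  · exact ((hZ.memLp q.1).mul_const (Y q.1)).integrable_mul ((hZ.memLp q.2).mul_const (Y q.2))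
  · refine Integrable.mono' (integrable_const (K * (B * B))) ?_ (.of_forall fun q => ?_)
    · exact hm.norm.stronglyMeasurable.integral_prod_right'.aestronglyMeasurable
    · rw [Real.norm_eq_abs, abs_of_nonneg (integral_nonneg fun ω => norm_nonneg _)]
      have : ∀ ω, ‖Z q.1 ω * Y q.1 * (Z q.2 ω * Y q.2)‖
          = |Z q.1 ω * Z q.2 ω| * (|Y q.1| * |Y q.2|) := by
        intro ω
        rw [← abs_mul (Y _), ← abs_mul, Real.norm_eq_abs]; congr 1; ring
      simp_rw [this]
      rw [integral_mul_const]
      have hK : 0 ≤ K := (integral_nonneg fun ω => sq_nonneg _).trans (hZ.bound q.1)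
      refine mul_le_mul (hZ.integral_abs_mul_le _ _) ?_ (by positivity) hK
      exact mul_le_mul (hB _) (hB _) (abs_nonneg _) ((abs_nonneg _).trans (hB q.1))

/-- The square of the integral as a double integral. Fubini's theorem for products needs no
integrability. -/
theorem sq_integral_eq {Ω : Type*} {Z : S → Ω → ℝ} (ω : Ω) : (∫ x, Z x ω * Y x ∂σ) ^ 2
    = ∫ q, Z q.1 ω * Y q.1 * (Z q.2 ω * Y q.2) ∂(σ.prod σ) := by
  rw [integral_prod_mul (fun x => Z x ω * Y x) (fun x => Z x ω * Y x), pow_two]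

theorem IsBoundedL2.measurable_integral (hZ : IsBoundedL2 Z μ K) (hY : Measurable Y) :
    Measurable fun ω => ∫ x, Z x ω * Y x ∂σ := by
  have h : Measurable fun q : Ω × S => Z q.2 q.1 * Y q.2 :=
    (hZ.measurable.comp measurable_swap).mul (hY.comp measurable_snd)
  exact h.stronglyMeasurable.integral_prod_right'.measurable

theorem IsBoundedL2.memLp_integral [IsProbabilityMeasure μ] (hZ : IsBoundedL2 Z μ K)
    (hY : Measurable Y)
    (hB : ∀ x, |Y x| ≤ B) : MemLp (fun ω => ∫ x, Z x ω * Y x ∂σ) 2 μ := by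
  rw [memLp_two_iff_integrable_sq (hZ.measurable_integral hY).aestronglyMeasurable]
  simp_rw [sq_integral_eq]
  exact (hZ.integrable_pair (σ := σ) hY hB).integral_prod_right

theorem IsBoundedL2.integral_sq_integral [IsProbabilityMeasure μ] (hZ : IsBoundedL2 Z μ K)
    (hY : Measurable Y)
    (hB : ∀ x, |Y x| ≤ B) :
    ∫ ω, (∫ x, Z x ω * Y x ∂σ) ^ 2 ∂μ
      = ∫ q : S × S, (∫ ω, Z q.1 ω * Z q.2 ω ∂μ) * Y q.1 * Y q.2 ∂(σ.prod σ) := by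
  simp_rw [sq_integral_eq]
  rw [← integral_integral_swap (f := fun (q : S × S) ω => Z q.1 ω * Y q.1 * (Z q.2 ω * Y q.2))
    (hZ.integrable_pair hY hB)]
  refine integral_congr_ae (.of_forall fun q => ?_)
  simp only
  rw [mul_assoc, ← integral_mul_const]
  refine integral_congr_ae (.of_forall fun ω => ?_)
  simp only; ring

theorem IsBoundedL2.integral_mul_integral_eq_zero [IsProbabilityMeasure μ] (hZ : IsBoundedL2 Z μ K)
    (hY : Measurable Y)
    (hB : ∀ x, |Y x| ≤ B) {u : Ω → ℝ} (hu : MemLp u 2 μ) (h0 : ∀ x, ∫ ω, u ω * Z x ω ∂μ = 0) :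
    ∫ ω, u ω * (∫ x, Z x ω * Y x ∂σ) ∂μ = 0 := by
  have hi : Integrable (fun q : S × Ω => u q.2 * (Z q.1 q.2 * Y q.1)) (σ.prod μ) := by
    have h1 : MemLp (fun q : S × Ω => u q.2) 2 (σ.prod μ) := hu.comp_snd σ
    have h2 := h1.integrable_mul (hZ.memLp_prod (σ := σ))
    have h3 := h2.mul_bdd (c := B) (g := fun q : S × Ω => Y q.1)
      (hY.comp measurable_fst).aestronglyMeasurable (.of_forall fun q => hB q.1)
    refine h3.congr (.of_forall fun q => ?_)
    simp only [Pi.mul_apply]; ring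
  simp_rw [← integral_const_mul]
  rw [← integral_integral_swap (f := fun (x : S) ω => u ω * (Z x ω * Y x)) hi]
  simp_rw [← mul_assoc, integral_mul_const, h0]
  simp

/-- The integral of a square integrable field is an almost sure limit of linear combinations of the
values of the field, which also converge in mean square: it lies in the closed linear span. -/
theorem IsBoundedL2.exists_seq_tendsto [IsProbabilityMeasure μ] (hZ : IsBoundedL2 Z μ K)
    (hY : Measurable Y)
    (hB : ∀ x, |Y x| ≤ B) :
    ∃ c : ℕ → S →₀ ℝ,
      (∀ᵐ ω ∂μ, Filter.Tendsto (fun n => ∑ x ∈ (c n).support, c n x * Z x ω) Filter.atTop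
        (𝓝 (∫ x, Z x ω * Y x ∂σ))) ∧
      Filter.Tendsto (fun n => ∫ ω, (∑ x ∈ (c n).support, c n x * Z x ω) ^ 2 ∂μ) Filter.atTop
        (𝓝 (∫ ω, (∫ x, Z x ω * Y x ∂σ) ^ 2 ∂μ)) := by
  have hz := hZ.memLp_integral (σ := σ) hY hB
  set v : S → Lp ℝ 2 μ := fun x => (hZ.memLp x).toLp _ with hv
  set z : Lp ℝ 2 μ := hz.toLp _ with hzdef
  have hmem : z ∈ (Submodule.span ℝ (Set.range v)).topologicalClosure := by
    -- A variable orthogonal to all values of the field is orthogonal to its integral.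
    rw [← Submodule.orthogonal_orthogonal_eq_closure, Submodule.mem_orthogonal]
    intro u hu
    rw [Submodule.mem_orthogonal'] at hu
    have h0 : ∀ x, ∫ ω, u ω * Z x ω ∂μ = 0 := by
      intro x
      have := hu (v x) (Submodule.subset_span ⟨x, rfl⟩)
      rw [L2.inner_def] at this
      rw [← this]
      refine integral_congr_ae ?_
      filter_upwards [(hZ.memLp x).coeFn_toLp] with ω hω
      simp only [hv, hω]
      simp [mul_comm]
    have h1 := hZ.integral_mul_integral_eq_zero (σ := σ) hY hB (Lp.memLp u) h0
    rw [L2.inner_def, ← h1]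
    refine integral_congr_ae ?_
    filter_upwards [hz.coeFn_toLp] with ω hω
    rw [hzdef, hω]
    simp [mul_comm]
  have hmem' : z ∈ closure (Submodule.span ℝ (Set.range v) : Set (Lp ℝ 2 μ)) := by
    rwa [← Submodule.topologicalClosure_coe]
  obtain ⟨s, hs, hlim⟩ := mem_closure_iff_seq_limit.1 hmem'
  choose c hc using fun n => Finsupp.mem_span_range_iff_exists_finsupp.1 (hs n)
  have hcoe : ∀ n, (s n : Ω → ℝ) =ᵐ[μ] fun ω => ∑ x ∈ (c n).support, c n x * Z x ω := by
    intro n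
    have h1 : s n = ∑ x ∈ (c n).support, c n x • v x := by rw [← hc n]; rfl
    have h2 : ∀ x, (c n x • v x : Lp ℝ 2 μ) =ᵐ[μ] fun ω => c n x * Z x ω := by
      intro x
      filter_upwards [Lp.coeFn_smul (c n x) (v x), (hZ.memLp x).coeFn_toLp] with ω h3 h4
      rw [h3]; simp [hv, h4]
    rw [h1]
    have h5 : ∀ᵐ ω ∂μ, ∀ x ∈ (c n).support, (c n x • v x : Lp ℝ 2 μ) ω = c n x * Z x ω :=
      (Finset.eventually_all _).2 fun x _ => h2 x
    filter_upwards [Lp.coeFn_finsetSum (c n).support fun x => c n x • v x, h5] with ω h6 h7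
    rw [h6, Finset.sum_apply]
    exact Finset.sum_congr rfl h7
  have hsq : ∀ n, ∫ ω, (∑ x ∈ (c n).support, c n x * Z x ω) ^ 2 ∂μ = ‖s n‖ ^ 2 := by
    intro n
    rw [← real_inner_self_eq_norm_sq, L2.inner_def]
    refine integral_congr_ae ?_
    filter_upwards [hcoe n] with ω hω
    rw [hω]; simp [pow_two]
  have hsqz : ∫ ω, (∫ x, Z x ω * Y x ∂σ) ^ 2 ∂μ = ‖z‖ ^ 2 := by
    rw [← real_inner_self_eq_norm_sq, L2.inner_def]
    refine integral_congr_ae ?_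
    filter_upwards [hz.coeFn_toLp] with ω hω
    rw [hzdef, hω]; simp [pow_two]
  -- Convergence in mean square gives almost sure convergence along a subsequence.
  obtain ⟨ns, hns, hae⟩ := (tendstoInMeasure_of_tendsto_Lp hlim).exists_seq_tendsto_ae
  refine ⟨fun n => c (ns n), ?_, ?_⟩
  · filter_upwards [hae, hz.coeFn_toLp, ae_all_iff.2 fun n => hcoe (ns n)] with ω h1 h2 h3
    rw [hzdef, h2] at h1
    simpa only [h3] using h1
  · simp_rw [hsq, hsqz]
    exact ((hlim.comp hns.tendsto_atTop).norm).pow 2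

/-- The integral of a centered Gaussian field is Gaussian, and almost surely equal to a measurable
function of the field. -/
theorem IsBoundedL2.gaussian_integral [IsProbabilityMeasure μ] (hZ : IsBoundedL2 Z μ K)
    (hG : IsGaussianProcess Z μ)
    (h0 : ∀ x, ∫ ω, Z x ω ∂μ = 0) (hY : Measurable Y) (hB : ∀ x, |Y x| ≤ B) {v : ℝ}
    (hv : ∫ ω, (∫ x, Z x ω * Y x ∂σ) ^ 2 ∂μ = v) :
    (∃ ψ : (S → ℝ) → ℝ, Measurable ψ ∧
      (fun ω => ∫ x, Z x ω * Y x ∂σ) =ᵐ[μ] fun ω => ψ fun x => Z x ω) ∧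
    μ.map (fun ω => ∫ x, Z x ω * Y x ∂σ) = gaussianReal 0 v.toNNReal := by
  obtain ⟨c, hc, hc2⟩ := hZ.exists_seq_tendsto (σ := σ) hY hB
  have hmz := hZ.measurable_integral (σ := σ) hY
  have hZm : ∀ x, Measurable (Z x) := fun x => hZ.measurable.of_uncurry_left
  refine ⟨⟨fun f => Filter.limsup (fun n => ∑ x ∈ (c n).support, c n x * f x) Filter.atTop,
    Measurable.limsup fun n => by fun_prop, ?_⟩, ?_⟩
  · filter_upwards [hc] with ω hω
    exact hω.limsup_eq.symm
  · have hv0 : 0 ≤ v := hv ▸ integral_nonneg fun ω => sq_nonneg _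
    have : IsProbabilityMeasure (μ.map fun ω => ∫ x, Z x ω * Y x ∂σ) :=
      Measure.isProbabilityMeasure_map hmz.aemeasurable
    -- The characteristic functions of the approximating Gaussian variables converge.
    refine Measure.ext_of_charFun (funext fun t => ?_)
    rw [charFun_gaussianReal, charFun_apply_real, integral_map hmz.aemeasurable (by fun_prop)]
    set g : ℕ → Ω → ℝ := fun n ω => ∑ x ∈ (c n).support, c n x * Z x ω with hg
    have hgm : ∀ n, Measurable (g n) := fun n => by
      have := hZm
      exact Finset.measurable_sum _ fun x _ => (hZm x).const_mul _
    have hlaw : ∀ n, ∫ ω, Complex.exp (t * g n ω * Complex.I) ∂μ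
        = Complex.exp (-((∫ ω, g n ω ^ 2 ∂μ : ℝ) * t ^ 2 / 2)) := by
      intro n
      have hl : HasGaussianLaw (g n) μ := (hG.smul (c n)).hasGaussianLaw_fun_sum
      have hm0 : ∫ ω, g n ω ∂μ = 0 := by
        simp only [hg]
        rw [integral_finsetSum _ fun x _ => ((hZ.memLp x).integrable one_le_two).const_mul _]
        simp [integral_const_mul, h0]
      have e := charFun_gaussianReal (μ := ∫ ω, g n ω ∂μ) (v := Var[g n; μ].toNNReal) t
      rw [← hl.map_eq_gaussianReal, charFun_apply_real,
        integral_map (hgm n).aemeasurable (by fun_prop)] at e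
      rw [e, hm0, variance_of_integral_eq_zero (hgm n).aemeasurable hm0,
        Real.coe_toNNReal _ (integral_nonneg fun ω => sq_nonneg _)]
      simp
    have h1 : Filter.Tendsto (fun n => ∫ ω, Complex.exp (t * g n ω * Complex.I) ∂μ) Filter.atTop
        (𝓝 (∫ ω, Complex.exp (t * (∫ x, Z x ω * Y x ∂σ : ℝ) * Complex.I) ∂μ)) := by
      refine tendsto_integral_of_dominated_convergence (fun _ => 1) (fun n => ?_)
        (integrable_const _) (fun n => .of_forall fun ω => ?_) ?_
      · have := hgm n
        fun_prop
      · rw [← Complex.ofReal_mul, Complex.norm_exp_ofReal_mul_I]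
      · filter_upwards [hc] with ω hω
        have hcont : Continuous fun r : ℝ => Complex.exp (t * (r : ℂ) * Complex.I) := by fun_prop
        exact (hcont.tendsto _).comp hω
    simp_rw [hlaw] at h1
    have h2 : Filter.Tendsto (fun n => Complex.exp (-((∫ ω, g n ω ^ 2 ∂μ : ℝ) * t ^ 2 / 2)))
        Filter.atTop (𝓝 (Complex.exp (-((v : ℝ) * t ^ 2 / 2)))) := by
      rw [hv] at hc2
      have hcont : Continuous fun r : ℝ => Complex.exp (-((r : ℂ) * t ^ 2 / 2)) := by fun_prop
      exact (hcont.tendsto _).comp hc2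
    rw [tendsto_nhds_unique h1 h2, Real.coe_toNNReal _ hv0]
    simp

end GaussianIntegral

/-! ### Harmonic coefficients of the noise and of the autoregression -/

section

variable {Ω : Type*} [MeasurableSpace Ω] {μ : Measure Ω} {Z T : S2 → ℤ → Ω → ℝ} {C : ℕ → ℝ}

theorem exists_abs_sphHarm_le (ℓ : ℕ) (m : ℤ) : ∃ B, ∀ x, |sphHarm ℓ m x| ≤ B := by
  obtain ⟨B, hB⟩ := isCompact_univ.exists_bound_of_continuousOn
    (continuous_sphHarm ℓ m).continuousOn
  exact ⟨B, fun x => hB x trivial⟩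

theorem IsWhiteNoise.isBoundedL2 (hZ : IsWhiteNoise μ Z C) (t : ℤ) :
    IsBoundedL2 (fun x => Z x t) μ (∑' ℓ : ℕ, (2 * ℓ + 1) / (4 * Real.pi) * C ℓ) where
  measurable := hZ.measurable t
  memLp x := ((hZ.gaussian t).hasGaussianLaw_eval x).memLp_two
  bound x := by
    have h := hZ.covariance t x x
    have h1 : inner ℝ (x : E3) (x : E3) = 1 := by simp
    simp only [h1, eval_legendreP_of_sq_eq_one _ (one_pow 2), one_pow, mul_one] at h
    rw [h.tsum_eq]
    simp [pow_two]

/-- The quadratic form of an isotropic covariance function at a spherical harmonic. -/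
theorem IsWhiteNoise.integral_covariance (hZ : IsWhiteNoise μ Z C) (t : ℤ) (ℓ : ℕ) (m : ℤ)
    (hm : m.natAbs ≤ ℓ) :
    ∫ q : S2 × S2, (∫ ω, Z q.1 t ω * Z q.2 t ω ∂μ) * sphHarm ℓ m q.1 * sphHarm ℓ m q.2
      ∂(sphereMeasure.prod sphereMeasure) = C ℓ := by
  obtain ⟨B, hB⟩ := exists_abs_sphHarm_le ℓ m
  have hY := continuous_sphHarm ℓ m
  set c : ℕ → ℝ := fun i => (2 * i + 1) / (4 * Real.pi) * C i with hc
  set F : ℕ → S2 × S2 → ℝ := fun i q => c i *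
    ((legendreP i).eval (inner ℝ (q.1 : E3) (q.2 : E3)) * sphHarm ℓ m q.1 * sphHarm ℓ m q.2) with hF
  have hcont : ∀ i, Continuous fun q : S2 × S2 =>
      (legendreP i).eval (inner ℝ (q.1 : E3) (q.2 : E3)) * sphHarm ℓ m q.1 * sphHarm ℓ m q.2 :=
    fun i => ((continuous_kernel (legendreP i).continuous.continuousOn).mul
      (hY.comp continuous_fst)).mul (hY.comp continuous_snd)
  have hle : ∀ i (q : S2 × S2), ‖F i q‖ ≤ |c i| * (B * B) := by
    intro i q
    rw [Real.norm_eq_abs]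
    simp only [hF]
    rw [abs_mul (c i), abs_mul (_ * _), abs_mul ((legendreP i).eval _)]
    refine mul_le_mul_of_nonneg_left ?_ (abs_nonneg _)
    have h1 := abs_eval_legendreP_le (inner_mem_Icc q.1 q.2) i
    have hB0 : 0 ≤ B := (abs_nonneg _).trans (hB q.1)
    refine mul_le_mul ?_ (hB _) (abs_nonneg _) hB0
    calc _ ≤ 1 * B := mul_le_mul h1 (hB _) (abs_nonneg _) zero_le_one
      _ = B := one_mul B
  have hs := hasSum_integral_of_dominated_convergence (μ := sphereMeasure.prod sphereMeasure)
    (F := F) (f := fun q => (∫ ω, Z q.1 t ω * Z q.2 t ω ∂μ) * sphHarm ℓ m q.1 * sphHarm ℓ m q.2)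
    (fun i _ => |c i| * (B * B))
    (fun i => ((hcont i).const_mul (c i)).aestronglyMeasurable) (fun i => .of_forall (hle i))
    (.of_forall fun _ => hZ.summable.abs.mul_right _) (integrable_const _)
    (.of_forall fun q => by
      have := ((hZ.covariance t q.1 q.2).mul_right (sphHarm ℓ m q.1)).mul_right (sphHarm ℓ m q.2)
      simpa only [hF, hc, mul_assoc] using this)
  have hF2 : ∀ i, ∫ q, F i q ∂(sphereMeasure.prod sphereMeasure) = if i = ℓ then C ℓ else 0 := by
    intro i
    have hi : Integrable (fun q : S2 × S2 => (legendreP i).eval (inner ℝ (q.1 : E3) (q.2 : E3)) *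
        sphHarm ℓ m q.1 * sphHarm ℓ m q.2) (sphereMeasure.prod sphereMeasure) := by
      have := (hcont i).continuousOn.integrableOn_compact
        (μ := sphereMeasure.prod sphereMeasure) (K := Set.univ) isCompact_univ
      simpa using this
    simp only [hF]
    rw [integral_const_mul, integral_prod_symm _ hi]
    simp only
    simp_rw [integral_mul_const, integral_eval_mul_sphHarm, mul_assoc, ← pow_two]
    rw [integral_const_mul, integral_sphHarm_sq ℓ m hm, mul_one, legendreCoeff_legendreP]
    have hpi := Real.pi_pos
    split_ifs with h
    · subst h
      simp only [hc]
      field_simp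
    · simp
  rw [← hs.tsum_eq]
  simp_rw [hF2]
  rw [tsum_ite_eq]

/-- Identifiability, tested with spherical harmonics, forces a positive power spectrum. -/
theorem IsWhiteNoise.powerSpectrum_pos (hZ : IsWhiteNoise μ Z C) (hI : Identifiability μ Z)
    (ℓ : ℕ) : 0 < C ℓ := by
  rw [← hZ.integral_covariance 0 ℓ 0 (by simp)]
  obtain ⟨B, hB⟩ := exists_abs_sphHarm_le ℓ 0
  refine hI 0 (sphHarm ℓ 0) (MemLp.of_bound
    (continuous_sphHarm ℓ 0).aestronglyMeasurable B (.of_forall hB)) fun h => ?_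
  have h1 := integral_sphHarm_sq ℓ 0 (by simp)
  rw [integral_congr_ae (g := fun _ => (0 : ℝ)) (by filter_upwards [h] with x hx; simp [hx])] at h1
  simp at h1

/-- The harmonic coefficients of the white noise are, up to scaling, a standard Gaussian
sequence. -/
theorem IsWhiteNoise.exists_isStdGaussianSeq [IsProbabilityMeasure μ] (hZ : IsWhiteNoise μ Z C)
    {ℓ : ℕ} (hC : 0 < C ℓ) (m : ℤ) (hm : m.natAbs ≤ ℓ) :
    ∃ x : ℤ → Ω → ℝ, IsStdGaussianSeq x μ ∧
      ∀ᵐ ω ∂μ, ∀ t, harmCoeff Z ℓ m t ω = Real.sqrt (C ℓ) * x t ω := by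
  obtain ⟨B, hB⟩ := exists_abs_sphHarm_le ℓ m
  have hYm := (continuous_sphHarm ℓ m).measurable
  have hZm : ∀ t x, Measurable (Z x t) := fun t x =>
    (hZ.measurable t).of_uncurry_left (f := fun x ω => Z x t ω)
  have hr : Real.sqrt (C ℓ) ≠ 0 := (Real.sqrt_pos.2 hC).ne'
  have hg := fun t => (hZ.isBoundedL2 t).gaussian_integral (σ := sphereMeasure) (hZ.gaussian t)
    (fun x => hZ.centered x t) hYm hB (v := C ℓ) (by
      rw [(hZ.isBoundedL2 t).integral_sq_integral hYm hB, hZ.integral_covariance t ℓ m hm])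
  choose ψ hψm hψ using fun t => (hg t).1
  refine ⟨fun t ω => ψ t (fun x => Z x t ω) / Real.sqrt (C ℓ), ⟨fun t => ?_, fun t => ?_, ?_⟩, ?_⟩
  · exact ((hψm t).comp (measurable_pi_lambda _ fun x => hZm t x)).div_const _
  · have hl : HasLaw (fun ω => ψ t (fun x => Z x t ω)) (gaussianReal 0 (C ℓ).toNNReal) μ :=
      ⟨((hψm t).comp (measurable_pi_lambda _ fun x => hZm t x)).aemeasurable, by
        rw [← Measure.map_congr (hψ t), (hg t).2]⟩
    rw [(gaussianReal_div_const hl (Real.sqrt (C ℓ))).map_eq, zero_div]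
    congr 1
    ext
    simp [Real.sq_sqrt hC.le, hC.le, hC.ne']
  · exact hZ.indep.comp (fun t f => ψ t f / Real.sqrt (C ℓ)) fun t => (hψm t).div_const _
  · filter_upwards [ae_all_iff.2 hψ] with ω hω t
    rw [mul_div_cancel₀ _ hr, ← hω t]
    rfl

theorem integral_abs_le_sqrt [IsProbabilityMeasure μ] {f : Ω → ℝ} (hf : MemLp f 2 μ) :
    ∫ ω, |f ω| ∂μ ≤ Real.sqrt (∫ ω, f ω ^ 2 ∂μ) := by
  refine Real.le_sqrt_of_sq_le ?_
  have h := variance_nonneg (fun ω => |f ω|) μ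
  rw [variance_eq_sub (X := fun ω => |f ω|) hf.abs] at h
  simp only [Pi.pow_apply, sq_abs] at h
  linarith

variable {p : ℕ} {k : Fin p → ℝ → ℝ}

theorem IsSPHAR.memLp (hT : IsSPHAR μ k T Z) (x : S2) (t : ℤ) : MemLp (T x t) 2 μ :=
  (hT.gaussian.hasGaussianLaw_eval (x, t)).memLp_two

/-- A mean square continuous field is integrable over the sphere. -/
theorem IsSPHAR.integrable_prod [IsProbabilityMeasure μ] (hT : IsSPHAR μ k T Z) (t : ℤ) :
    Integrable (fun q : S2 × Ω => T q.1 t q.2) (sphereMeasure.prod μ) := by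
  have hi : ∀ x, Integrable (T x t) μ := fun x => (hT.memLp x t).integrable one_le_two
  rw [integrable_prod_iff (hT.measurable t).aestronglyMeasurable]
  refine ⟨.of_forall hi, integrable_of_continuous ?_⟩
  simp only [Real.norm_eq_abs]
  refine continuous_iff_continuousAt.2 fun x => ?_
  have h0 : Filter.Tendsto (fun y => Real.sqrt (∫ ω, (T y t ω - T x t ω) ^ 2 ∂μ)) (𝓝 x) (𝓝 0) := by
    have := (Real.continuous_sqrt.tendsto 0).comp (hT.mean_square_continuous x t)
    rwa [Real.sqrt_zero] at this
  rw [ContinuousAt, tendsto_iff_norm_sub_tendsto_zero]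
  refine squeeze_zero (fun y => norm_nonneg _) (fun y => ?_) h0
  refine le_trans ?_ (integral_abs_le_sqrt ((hT.memLp y t).sub (hT.memLp x t)))
  rw [← integral_sub (hi y).abs (hi x).abs]
  refine norm_integral_le_of_norm_le ((hi y).sub (hi x)).abs (.of_forall fun ω => ?_)
  exact abs_abs_sub_abs_le_abs_sub _ _

theorem measurable_kernelOp {κ : ℝ → ℝ} (hκ : ContinuousOn κ (Set.Icc (-1) 1)) {f : S2 → Ω → ℝ}
    (hf : Measurable fun q : S2 × Ω => f q.1 q.2) :
    Measurable fun q : S2 × Ω => kernelOp κ (fun y => f y q.2) q.1 := by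
  have h1 : Measurable fun r : (S2 × Ω) × S2 => κ (inner ℝ (r.1.1 : E3) (r.2 : E3)) :=
    (continuous_kernel hκ).measurable.comp
      (by fun_prop : Measurable fun r : (S2 × Ω) × S2 => (r.1.1, r.2))
  have h2 : Measurable fun r : (S2 × Ω) × S2 => f r.2 r.1.2 :=
    hf.comp (by fun_prop : Measurable fun r : (S2 × Ω) × S2 => (r.2, r.1.2))
  exact (h1.mul h2).stronglyMeasurable.integral_prod_right'.measurable

/-- The convolution operator acts on the harmonic coefficients by multiplication. -/
theorem integral_kernelOp_mul_sphHarm {κ : ℝ → ℝ} (hκ : ContinuousOn κ (Set.Icc (-1) 1))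
    {f : S2 → ℝ} (hf : Integrable f sphereMeasure) (ℓ : ℕ) (m : ℤ) :
    Integrable (fun x => kernelOp κ f x * sphHarm ℓ m x) sphereMeasure ∧
    ∫ x, kernelOp κ f x * sphHarm ℓ m x ∂sphereMeasure
      = legendreCoeff κ ℓ * ∫ y, f y * sphHarm ℓ m y ∂sphereMeasure := by
  have hY := continuous_sphHarm ℓ m
  have hcont : Continuous fun q : S2 × S2 => κ (inner ℝ (q.1 : E3) (q.2 : E3)) * sphHarm ℓ m q.1 :=
    (continuous_kernel hκ).mul (hY.comp continuous_fst)
  obtain ⟨B, hB⟩ := isCompact_univ.exists_bound_of_continuousOn hcont.continuousOn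
  have hi : Integrable (fun q : S2 × S2 => κ (inner ℝ (q.1 : E3) (q.2 : E3)) * sphHarm ℓ m q.1
      * f q.2) (sphereMeasure.prod sphereMeasure) :=
    (hf.comp_snd sphereMeasure).bdd_mul hcont.aestronglyMeasurable
      (.of_forall fun q => hB q trivial)
  have e : ∀ x, kernelOp κ f x * sphHarm ℓ m x
      = ∫ y, κ (inner ℝ (x : E3) (y : E3)) * sphHarm ℓ m x * f y ∂sphereMeasure := by
    intro x
    rw [kernelOp, ← integral_mul_const]
    refine integral_congr_ae (.of_forall fun y => ?_)
    simp only; ring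
  simp_rw [e]
  refine ⟨hi.integral_prod_left, ?_⟩
  rw [integral_integral_swap (f := fun x y : S2 =>
      κ (inner ℝ (x : E3) (y : E3)) * sphHarm ℓ m x * f y) hi, ← integral_const_mul]
  refine integral_congr_ae (.of_forall fun y => ?_)
  simp only
  rw [integral_mul_const, integral_kernel_mul_sphHarm hκ]
  ring

/-- The harmonic coefficients solve a scalar autoregressive equation. -/
theorem IsSPHAR.harmCoeff_eq [IsProbabilityMeasure μ] (hT : IsSPHAR μ k T Z)
    (hZ : IsWhiteNoise μ Z C) (ℓ : ℕ) (m : ℤ) :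
    ∀ᵐ ω ∂μ, ∀ t, harmCoeff T ℓ m t ω
      = ∑ j : Fin p, arCoeff k ℓ j * harmCoeff T ℓ m (t - ((j : ℕ) + 1 : ℤ)) ω
        + harmCoeff Z ℓ m t ω := by
  have hTi : ∀ᵐ ω ∂μ, ∀ t, Integrable (fun x => T x t ω) sphereMeasure :=
    ae_all_iff.2 fun t => (hT.integrable_prod t).prod_left_ae
  have hZi : ∀ᵐ ω ∂μ, ∀ t, Integrable (fun x => Z x t ω) sphereMeasure :=
    ae_all_iff.2 fun t => ((hZ.isBoundedL2 t).memLp_prod.integrable one_le_two).prod_left_ae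
  have heq : ∀ᵐ ω ∂μ, ∀ t, ∀ᵐ x ∂sphereMeasure, T x t ω =
      ∑ j : Fin p, kernelOp (k j) (fun y => T y (t - ((j : ℕ) + 1 : ℤ)) ω) x + Z x t ω := by
    refine ae_all_iff.2 fun t => ?_
    refine (Measure.ae_ae_comm (p := fun (x : S2) (ω : Ω) => T x t ω =
      ∑ j : Fin p, kernelOp (k j) (fun y => T y (t - ((j : ℕ) + 1 : ℤ)) ω) x + Z x t ω) ?_).1
      (.of_forall fun x => hT.equation x t)
    refine measurableSet_eq_fun (hT.measurable t) ((Finset.measurable_sum _ fun j _ => ?_).add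
      (hZ.measurable t))
    exact measurable_kernelOp (hT.kernel_continuous j) (hT.measurable _)
  filter_upwards [hTi, hZi, heq] with ω h1 h2 h3 t
  obtain ⟨B, hB⟩ := exists_abs_sphHarm_le ℓ m
  have hj := fun j : Fin p => integral_kernelOp_mul_sphHarm (hT.kernel_continuous j)
    (h1 (t - ((j : ℕ) + 1 : ℤ))) ℓ m
  have hZY : Integrable (fun x => Z x t ω * sphHarm ℓ m x) sphereMeasure :=
    (h2 t).mul_bdd (continuous_sphHarm ℓ m).aestronglyMeasurable (.of_forall hB)
  have e : harmCoeff T ℓ m t ω = ∫ x, (∑ j : Fin p,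
      kernelOp (k j) (fun y => T y (t - ((j : ℕ) + 1 : ℤ)) ω) x * sphHarm ℓ m x
        + Z x t ω * sphHarm ℓ m x) ∂sphereMeasure := by
    refine integral_congr_ae ?_
    filter_upwards [h3 t] with x hx
    rw [hx, add_mul, Finset.sum_mul]
  rw [e, integral_add (integrable_finsetSum _ fun j _ => (hj j).1) hZY,
    integral_finsetSum _ fun j _ => (hj j).1]
  simp only [(hj _).2]
  rfl

end

/-! ### The restricted eigenvalue condition -/

section Spectral

variable {p : ℕ} {k : Fin p → ℝ → ℝ}

theorem continuous_norm_arPoly_sq (k : Fin p → ℝ → ℝ) (ℓ : ℕ) :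
    Continuous fun z : Circle => ‖arPoly k ℓ (z : ℂ)‖ ^ 2 := by
  unfold arPoly
  fun_prop

theorem norm_arPoly_sq_le_muMax (k : Fin p → ℝ → ℝ) (ℓ : ℕ) {z : ℂ} (hz : ‖z‖ = 1) :
    ‖arPoly k ℓ z‖ ^ 2 ≤ muMax k ℓ :=
  le_ciSup (f := fun z : Circle => ‖arPoly k ℓ (z : ℂ)‖ ^ 2)
    (isCompact_range (continuous_norm_arPoly_sq k ℓ)).bddAbove
    ⟨z, mem_sphere_zero_iff_norm.2 hz⟩

theorem muMin_pos (hS : StationarityCondition k) (ℓ : ℕ) : 0 < muMin k ℓ := by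
  obtain ⟨z, -, hz⟩ := isCompact_univ.exists_isMinOn Set.univ_nonempty
    (continuous_norm_arPoly_sq k ℓ).continuousOn
  have h0 : 0 < ‖arPoly k ℓ (z : ℂ)‖ ^ 2 :=
    pow_pos (norm_pos_iff.2 (hS ℓ z z.norm_coe.le)) 2
  exact h0.trans_le (le_ciInf fun y => hz (Set.mem_univ y))

theorem muMin_le_muMax (k : Fin p → ℝ → ℝ) (ℓ : ℕ) : muMin k ℓ ≤ muMax k ℓ :=
  (ciInf_le (f := fun z : Circle => ‖arPoly k ℓ (z : ℂ)‖ ^ 2)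
    ⟨0, by rintro _ ⟨z, rfl⟩; positivity⟩ 1).trans
    (norm_arPoly_sq_le_muMax k ℓ (by simp))

theorem muMax_pos (hS : StationarityCondition k) (ℓ : ℕ) : 0 < muMax k ℓ :=
  (muMin_pos hS ℓ).trans_le (muMin_le_muMax k ℓ)

/-- The ratio `μ_max / μ_min` is at least one, so that `ω_N ≥ c`. -/
theorem le_omegaN (hS : StationarityCondition k) {c : ℝ} (hc : 0 ≤ c) {L : ℕ} (hL : 1 ≤ L) :
    c ≤ omegaN c k L := by
  have h : 1 ≤ ⨆ ℓ : Fin L, muMax k ℓ / muMin k ℓ :=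
    ((one_le_div (muMin_pos hS 0)).2 (muMin_le_muMax k 0)).trans
      (le_ciSup (f := fun ℓ : Fin L => muMax k ℓ / muMin k ℓ) (Set.finite_range _).bddAbove
        ⟨0, hL⟩)
  simpa [omegaN] using mul_le_mul_of_nonneg_left h hc

end Spectral

section Gram

variable {Ω : Type*} {Z T : S2 → ℤ → Ω → ℝ} {C : ℕ → ℝ} {p : ℕ} {k : Fin p → ℝ → ℝ}

theorem isSymm_gammaHat (T : S2 → ℤ → Ω → ℝ) (p N ℓ : ℕ) (ω : Ω) :
    (gammaHat T p N ℓ ω).IsSymm := by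
  unfold gammaHat
  rw [Matrix.IsSymm, Matrix.transpose_smul, Matrix.transpose_mul, Matrix.transpose_transpose]

theorem dotProduct_gammaHat_mulVec (T : S2 → ℤ → Ω → ℝ) (N ℓ : ℕ) (ω : Ω) (θ : Fin p → ℝ) :
    θ ⬝ᵥ gammaHat T p N ℓ ω *ᵥ θ = 1 / ((N : ℝ) * (2 * ℓ + 1)) *
      ∑ m : Azimuth ℓ, ∑ i ∈ Finset.range N,
        (∑ j : Fin p, θ j * harmCoeff T ℓ m (p + 1 + i - ((j : ℕ) + 1 : ℤ)) ω) ^ 2 := by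
  rw [gammaHat, Matrix.smul_mulVec, dotProduct_smul, smul_eq_mul, ← Matrix.mulVec_mulVec,
    Matrix.dotProduct_mulVec, Matrix.vecMul_transpose]
  congr 1
  simp only [dotProduct, Fintype.sum_prod_type, ← pow_two]
  refine Finset.sum_congr rfl fun m _ => ?_
  rw [Finset.sum_range]
  refine Finset.sum_congr rfl fun i _ => ?_
  congr 1
  simp only [Matrix.mulVec, dotProduct, dataMatrix, Matrix.of_apply]
  exact Finset.sum_congr rfl fun j _ => mul_comm _ _

theorem dotProduct_gammaHat_mulVec_nonneg (T : S2 → ℤ → Ω → ℝ) (N ℓ : ℕ) (ω : Ω)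
    (θ : Fin p → ℝ) : 0 ≤ θ ⬝ᵥ gammaHat T p N ℓ ω *ᵥ θ := by
  rw [dotProduct_gammaHat_mulVec]
  positivity

theorem card_azimuth (ℓ : ℕ) : Fintype.card (Azimuth ℓ) = 2 * ℓ + 1 := by
  simp; omega

theorem Azimuth.natAbs_le {ℓ : ℕ} (m : Azimuth ℓ) : (m : ℤ).natAbs ≤ ℓ := by
  have := Finset.mem_Icc.1 m.2
  omega

theorem card_sigma_azimuth (L : ℕ) : Fintype.card (Σ ℓ : Fin L, Azimuth ℓ) = L ^ 2 := by
  rw [Fintype.card_sigma]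
  simp only [card_azimuth]
  rw [← Finset.sum_range (fun ℓ => 2 * ℓ + 1)]
  induction L with
  | zero => simp
  | succ n ih => rw [Finset.sum_range_succ, ih]; ring

/-- The event that the sum over the `N - p` times `2 p + 1 ≤ t ≤ N + p` of
`x(t - (i + 1)) x(t - (j + 1))` misses its mean by a fraction `δ` of the number of times: from below
if `i = j`, on either side if `i ≠ j`. -/
def badEvent (x : ℤ → Ω → ℝ) (N : ℕ) (δ : ℝ) (i j : Fin p) : Set Ω :=
  {ω | ¬ ((i = j → ((N - p : ℕ) : ℝ) * (1 - δ) ≤ ∑ s ∈ Finset.Ico p N,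
          x (p + 1 + s - ((i : ℕ) + 1 : ℤ)) ω * x (p + 1 + s - ((j : ℕ) + 1 : ℤ)) ω) ∧
      (i ≠ j → |∑ s ∈ Finset.Ico p N,
          x (p + 1 + s - ((i : ℕ) + 1 : ℤ)) ω * x (p + 1 + s - ((j : ℕ) + 1 : ℤ)) ω|
        ≤ ((N - p : ℕ) : ℝ) * δ))}

/-- Off the bad events of the `2 ℓ + 1` harmonic coefficients of the noise, the restricted
eigenvalue inequality at multipole `ℓ` holds with tolerance zero: the Gram matrix of the noise loses
a factor `3/4`, and so does the passage from `N` to `N - p` times, while `3/4 · 3/4 ≥ 1/2`. -/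
theorem curvature_mul_le_of_notMem_badEvent {ℓ N : ℕ} (hS : StationarityCondition k)
    (hC : 0 < C ℓ) (hp : 1 ≤ p) (hN : 4 * p ≤ N) {x : Azimuth ℓ → ℤ → Ω → ℝ} {ω : Ω}
    (hx : ∀ m t, harmCoeff Z ℓ (m : Azimuth ℓ) t ω = Real.sqrt (C ℓ) * x m t ω)
    (hT : ∀ (m : Azimuth ℓ) t, harmCoeff T ℓ m t ω
      = ∑ j : Fin p, arCoeff k ℓ j * harmCoeff T ℓ m (t - ((j : ℕ) + 1 : ℤ)) ω
        + harmCoeff Z ℓ m t ω)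
    (hω : ∀ (m : Azimuth ℓ) (i j : Fin p), ω ∉ badEvent (x m) N (1 / (4 * p)) i j)
    (θ : Fin p → ℝ) :
    curvature k C ℓ * ∑ i, θ i ^ 2 ≤ θ ⬝ᵥ gammaHat T p N ℓ ω *ᵥ θ := by
  have hp0 : (0 : ℝ) < p := by exact_mod_cast hp
  have hM := muMax_pos hS ℓ
  set n : ℝ := ((N - p : ℕ) : ℝ) with hn
  have hn34 : 3 / 4 * (N : ℝ) ≤ n := by
    rw [hn, Nat.cast_sub (by omega)]
    have : (4 : ℝ) * p ≤ N := by exact_mod_cast hN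
    linarith
  have hN0 : (0 : ℝ) < N := by exact_mod_cast (by omega : 0 < N)
  have hn0 : 0 ≤ n := Nat.cast_nonneg _
  have hsum : ∀ (m : Azimuth ℓ) (i j : Fin p), ∑ s ∈ Finset.Ico p N,
      harmCoeff Z ℓ m (p + 1 + s - ((i : ℕ) + 1 : ℤ)) ω *
        harmCoeff Z ℓ m (p + 1 + s - ((j : ℕ) + 1 : ℤ)) ω = C ℓ * ∑ s ∈ Finset.Ico p N,
      x m (p + 1 + s - ((i : ℕ) + 1 : ℤ)) ω * x m (p + 1 + s - ((j : ℕ) + 1 : ℤ)) ω := by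
    intro m i j
    rw [Finset.mul_sum]
    refine Finset.sum_congr rfl fun s _ => ?_
    rw [hx, hx, mul_mul_mul_comm, Real.mul_self_sqrt hC.le]
  have key : ∀ m : Azimuth ℓ, 3 / 4 * (n * C ℓ) * ∑ i, θ i ^ 2 ≤ muMax k ℓ *
      ∑ i ∈ Finset.range N,
        (∑ j : Fin p, θ j * harmCoeff T ℓ m (p + 1 + i - ((j : ℕ) + 1 : ℤ)) ω) ^ 2 := by
    intro m
    refine sum_sq_lagged_ge (arCoeff k ℓ) (δ := 1 / (4 * p))
      (fun z hz => norm_arPoly_sq_le_muMax k ℓ hz)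
      (fun t => harmCoeff T ℓ m t ω) (fun t => harmCoeff Z ℓ m t ω) (hT m) N (by positivity)
      (by field_simp; norm_num) (by positivity) (fun j => ?_) (fun i j hij => ?_) θ
    · have h := not_not.1 (hω m j j)
      have h1 := mul_le_mul_of_nonneg_left (h.1 rfl) hC.le
      rw [hsum]
      linarith
    · have h := not_not.1 (hω m i j)
      have h1 := mul_le_mul_of_nonneg_left (h.2 hij) hC.le
      rw [hsum, abs_mul, abs_of_pos hC]
      linarith
  have hA := Finset.sum_le_sum fun m (_ : m ∈ (Finset.univ : Finset (Azimuth ℓ))) => key m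
  rw [Finset.sum_const, ← Finset.mul_sum, Finset.card_univ, card_azimuth, nsmul_eq_mul] at hA
  rw [dotProduct_gammaHat_mulVec, curvature]
  set Q := ∑ m : Azimuth ℓ, ∑ i ∈ Finset.range N,
        (∑ j : Fin p, θ j * harmCoeff T ℓ m (p + 1 + i - ((j : ℕ) + 1 : ℤ)) ω) ^ 2
  set S := ∑ i, θ i ^ 2 with hSdef
  have hS0 : 0 ≤ S := by positivity
  push_cast at hA
  rw [div_mul_eq_mul_div, one_div_mul_eq_div, div_le_div_iff₀ (by positivity) (by positivity)]
  have h2 : 1 / 2 * (N : ℝ) ≤ 3 / 4 * n := by linarith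
  have h3 := mul_le_mul_of_nonneg_right h2 (by positivity : 0 ≤ (2 * (ℓ : ℝ) + 1) * C ℓ * S)
  linarith

end Gram

section Concentration

variable {Ω : Type*} [MeasurableSpace Ω] {μ : Measure Ω} {p : ℕ}

theorem IsStdGaussianSeq.measure_badEvent_le [IsProbabilityMeasure μ] {x : ℤ → Ω → ℝ}
    (hx : IsStdGaussianSeq x μ) (N : ℕ) {δ : ℝ} (hδ : 0 ≤ δ) (hδ1 : δ ≤ 1) (i j : Fin p) :
    μ.real (badEvent x N δ i j) ≤ 4 * Real.exp (-(((N - p : ℕ) : ℝ) * δ ^ 2 / 16)) := by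
  set e : ℕ ↪ ℤ := ⟨fun s => p + 1 + s, fun a b h => by simpa using h⟩ with he
  set I : Finset ℤ := (Finset.Ico p N).map e with hI
  have hcard : I.card = N - p := by simp [hI]
  have hsum : ∀ f : ℤ → ℝ, ∑ t ∈ I, f t = ∑ s ∈ Finset.Ico p N, f (p + 1 + s) :=
    fun f => Finset.sum_map _ _ _
  by_cases hij : i = j
  · subst hij
    have h := hx.measure_sum_sq_le I ((i : ℕ) + 1 : ℤ) hδ
    simp only [hcard, hsum (fun t => x (t - ((i : ℕ) + 1 : ℤ)) _ *
      x (t - ((i : ℕ) + 1 : ℤ)) _)] at h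
    refine (measureReal_mono (fun ω hω => ?_)).trans (h.trans ?_)
    · simp only [badEvent, Set.mem_ofPred_eq, ne_eq, not_true_eq_false, false_imp_iff, and_true,
        true_imp_iff, not_le] at hω
      exact hω.le
    · have h1 : Real.exp (-(((N - p : ℕ) : ℝ) * δ ^ 2 / 8))
          ≤ Real.exp (-(((N - p : ℕ) : ℝ) * δ ^ 2 / 16)) := by
        apply Real.exp_le_exp.2
        have : 0 ≤ ((N - p : ℕ) : ℝ) * δ ^ 2 := by positivity
        linarith
      linarith [Real.exp_pos (-(((N - p : ℕ) : ℝ) * δ ^ 2 / 16))]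
  · have hab : ((i : ℕ) + 1 : ℤ) ≠ ((j : ℕ) + 1 : ℤ) := by
      have := Fin.val_ne_of_ne hij
      omega
    have h := hx.measure_abs_sum_mul_ge I hab hδ hδ1
    simp only [hcard, hsum (fun t => x (t - ((i : ℕ) + 1 : ℤ)) _ *
      x (t - ((j : ℕ) + 1 : ℤ)) _)] at h
    refine (measureReal_mono (fun ω hω => ?_)).trans h
    simp only [badEvent, Set.mem_ofPred_eq, hij, ne_eq, not_false_eq_true, false_imp_iff, true_and,
      true_imp_iff, not_le] at hω
    exact hω.le

end Concentration

section Main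

variable {Ω : Type*} [MeasurableSpace Ω] {μ : Measure Ω} {Z T : S2 → ℤ → Ω → ℝ} {C : ℕ → ℝ}
  {p : ℕ} {k : Fin p → ℝ → ℝ}

/-- The number of harmonic coefficients below `L`, times the number of pairs of lags, is
`(pL)²`; the union bound over these is beaten by the Gaussian tails. -/
theorem one_sub_le_measure_iInter [IsProbabilityMeasure μ] (hZ : IsWhiteNoise μ Z C)
    (hT : IsSPHAR μ k T Z) (hC : ∀ ℓ, 0 < C ℓ) (hS : StationarityCondition k) (hp : 1 ≤ p)
    {L N : ℕ} (hN : 4 * p ≤ N) :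
    1 - ((p : ℝ) * L) ^ 2 * (4 * Real.exp (-(3 * N / (1024 * p ^ 2)))) ≤
      μ.real {ω | ∀ ℓ < L, ∀ θ : Fin p → ℝ,
        curvature k C ℓ * ∑ i, θ i ^ 2 ≤ θ ⬝ᵥ gammaHat T p N ℓ ω *ᵥ θ} := by
  have hp0 : (0 : ℝ) < p := by exact_mod_cast hp
  have hp1 : (1 : ℝ) ≤ p := by exact_mod_cast hp
  choose x hx hxe using fun (ℓ : ℕ) (m : Azimuth ℓ) =>
    hZ.exists_isStdGaussianSeq (hC ℓ) m m.natAbs_le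
  set A := {ω | ∀ ℓ < L, ∀ θ : Fin p → ℝ,
        curvature k C ℓ * ∑ i, θ i ^ 2 ≤ θ ⬝ᵥ gammaHat T p N ℓ ω *ᵥ θ} with hA
  set B : ((Σ ℓ : Fin L, Azimuth ℓ) × Fin p × Fin p) → Set Ω := fun r =>
    badEvent (x r.1.1 r.1.2) N (1 / (4 * p)) r.2.1 r.2.2 with hB
  have hδ1 : 1 / (4 * (p : ℝ)) ≤ 1 := by
    rw [div_le_one (by positivity)]; linarith
  have hBle : ∀ r, μ.real (B r) ≤ 4 * Real.exp (-(3 * N / (1024 * p ^ 2))) := by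
    intro r
    refine ((hx _ _).measure_badEvent_le N (by positivity) hδ1 _ _).trans ?_
    refine mul_le_mul_of_nonneg_left (Real.exp_le_exp.2 (neg_le_neg ?_)) (by norm_num)
    have h : 3 / 4 * (N : ℝ) ≤ ((N - p : ℕ) : ℝ) := by
      rw [Nat.cast_sub (by omega)]
      have : (4 : ℝ) * p ≤ N := by exact_mod_cast hN
      linarith
    have h1 := mul_le_mul_of_nonneg_right h (by positivity : 0 ≤ 1 / (256 * (p : ℝ) ^ 2))
    refine le_trans (le_of_eq ?_) (h1.trans (le_of_eq ?_)) <;> field_simp <;> ring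
  -- The set `A` need not be measurable: subadditivity of the outer measure is enough.
  have hae : ∀ᵐ ω ∂μ, ω ∈ A ∪ ⋃ r, B r := by
    filter_upwards [ae_all_iff.2 fun ℓ => ae_all_iff.2 (hxe ℓ),
      ae_all_iff.2 fun ℓ => ae_all_iff.2 fun m : Azimuth ℓ => hT.harmCoeff_eq hZ ℓ m]
      with ω h1 h2
    by_contra hω
    rw [Set.mem_union, not_or, Set.mem_iUnion, not_exists] at hω
    exact hω.1 fun ℓ hℓ θ => curvature_mul_le_of_notMem_badEvent hS (hC ℓ) hp hN (h1 ℓ) (h2 ℓ)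
      (fun m i j => hω.2 (⟨⟨ℓ, hℓ⟩, m⟩, i, j)) θ
  have h1 : (1 : ℝ) = μ.real (A ∪ ⋃ r, B r) := by
    rw [measureReal_congr (s := A ∪ ⋃ r, B r) (t := Set.univ) (Filter.eventuallyEq_univ.2 hae),
      probReal_univ]
  have h2 : μ.real (⋃ r, B r) ≤ ((p : ℝ) * L) ^ 2 * (4 * Real.exp (-(3 * N / (1024 * p ^ 2)))) := by
    refine (measureReal_iUnion_fintype_le B).trans ((Finset.sum_le_sum fun r _ => hBle r).trans ?_)
    rw [Finset.sum_const, Finset.card_univ, Fintype.card_prod, card_sigma_azimuth,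
      Fintype.card_prod, Fintype.card_fin, nsmul_eq_mul]
    push_cast
    refine le_of_eq ?_
    ring
  have h3 := measureReal_union_le (μ := μ) A (⋃ r, B r)
  linarith

end Main

end Sphar

end

theorem mainTheorem3 :
    ∀ b : ℝ, 0 < b → ∃ c₁ c₂ c : ℝ, 0 < c₁ ∧ 0 < c₂ ∧ 0 < c ∧
      ∀ (Ω : Type*) [MeasurableSpace Ω] (μ : Measure Ω) [IsProbabilityMeasure μ]
        (p L N : ℕ) (k : Fin p → ℝ → ℝ) (T Z : Sphar.S2 → ℤ → Ω → ℝ) (C : ℕ → ℝ),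
        1 ≤ p → 1 ≤ L → 1 ≤ N →
        Sphar.IsWhiteNoise μ Z C →
        Sphar.IsSPHAR μ k T Z →
        Sphar.Identifiability μ Z →
        Sphar.StationarityCondition k →
        b * (max (Sphar.omegaN (c * p) k L ^ 2) 1 * Sphar.maxSparsity k L *
          Real.log ((p : ℝ) * L)) ≤ N →
        1 - c₁ * Real.exp (-c₂ * N * min ((Sphar.omegaN (c * p) k L ^ 2)⁻¹) 1) ≤
          μ.real (⋂ ℓ ∈ Finset.range L,
            {ω | Sphar.SatisfiesRE (Sphar.gammaHat T p N ℓ ω) (Sphar.curvature k C ℓ)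
              (Sphar.tolerance k C (Sphar.omegaN (c * p) k L) L N ℓ)}) := by
  intro b _
  -- With `c = 32` one has `ω² ≥ 1024 p²`, so that the tails `exp (-n / (256 p²))` at `n ≥ 3 N / 4`
  -- are at most `exp (-3 N / ω²)`.
  refine ⟨4, 1, 32, by norm_num, by norm_num, by norm_num, ?_⟩
  intro Ω _ μ _ p L N k T Z C hp hL hN hZ hT hI hS _
  have hC : ∀ ℓ, 0 < C ℓ := hZ.powerSpectrum_pos hI
  have hp1 : (1 : ℝ) ≤ p := by exact_mod_cast hp
  have hL1 : (1 : ℝ) ≤ L := by exact_mod_cast hL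
  have hN0 : (0 : ℝ) < N := by exact_mod_cast hN
  have hpL : 1 ≤ (p : ℝ) * L := one_le_mul_of_one_le_of_one_le hp1 hL1
  have hlog : 0 ≤ Real.log ((p : ℝ) * L) := Real.log_nonneg hpL
  have hω := Sphar.le_omegaN hS (c := 32 * p) (by positivity) hL
  set w : ℝ := Sphar.omegaN (32 * p) k L with hw
  have hw0 : 0 < w := by linarith
  have hw2 : 1024 * (p : ℝ) ^ 2 ≤ w ^ 2 := by
    have := pow_le_pow_left₀ (by positivity) hω 2
    linarith
  have hw1 : 1 ≤ w ^ 2 := by nlinarith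
  have hα : ∀ ℓ, 0 < Sphar.curvature k C ℓ := fun ℓ =>
    div_pos (hC ℓ) (mul_pos two_pos (Sphar.muMax_pos hS ℓ))
  have hτ : ∀ ℓ, 0 ≤ Sphar.tolerance k C w L N ℓ := fun ℓ =>
    mul_nonneg (mul_nonneg (hα ℓ).le (by positivity)) (div_nonneg hlog hN0.le)
  rw [min_eq_left (inv_le_one_of_one_le₀ hw1)]
  by_cases h1 : (N : ℝ) ≤ w ^ 2
  · -- The bound is trivial, since the right-hand side is at most `1 - 4 / e < 0`.
    refine le_trans ?_ measureReal_nonneg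
    have h2 : (-1 : ℝ) ≤ -1 * N * (w ^ 2)⁻¹ := by
      rw [← div_eq_mul_inv, le_div_iff₀ (by positivity)]; linarith
    have h3 := Real.exp_le_exp.2 h2
    have h4 : (1 / 4 : ℝ) ≤ Real.exp (-1) := by
      rw [Real.exp_neg, one_div]
      exact inv_anti₀ (Real.exp_pos 1) (by linarith [Real.exp_one_lt_d9])
    linarith
  by_cases h2 : (N : ℝ) ≤ w ^ 2 * Real.log ((p : ℝ) * L)
  · -- The tolerance is at least the curvature, so that the left-hand side of the restricted
    -- eigenvalue inequality is never positive.
    have huniv : (⋂ ℓ ∈ Finset.range L, {ω | Sphar.SatisfiesRE (Sphar.gammaHat T p N ℓ ω)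
        (Sphar.curvature k C ℓ) (Sphar.tolerance k C w L N ℓ)}) = Set.univ := by
      refine Set.eq_univ_of_forall fun ω => Set.mem_iInter₂.2 fun ℓ _ =>
        ⟨Sphar.isSymm_gammaHat T p N ℓ ω, hα ℓ, hτ ℓ, fun θ => ?_⟩
      refine le_trans ?_ (Sphar.dotProduct_gammaHat_mulVec_nonneg T N ℓ ω θ)
      have h3 : Sphar.curvature k C ℓ ≤ Sphar.tolerance k C w L N ℓ := by
        rw [Sphar.tolerance, max_eq_left hw1, mul_assoc]
        refine le_mul_of_one_le_right (hα ℓ).le ?_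
        rwa [← mul_div_assoc, one_le_div hN0]
      have h4 := mul_le_mul h3 (Sphar.sum_sq_le_sq_sum_abs θ) (by positivity) (hτ ℓ)
      linarith
    rw [huniv, probReal_univ]
    linarith [Real.exp_pos (-1 * N * (w ^ 2)⁻¹)]
  push Not at h1 h2
  have hN4 : 4 * p ≤ N := by
    have : (4 : ℝ) * p ≤ N := by nlinarith
    exact_mod_cast this
  refine le_trans ?_ ((Sphar.one_sub_le_measure_iInter hZ hT hC hS hp (L := L) hN4).trans
    (measureReal_mono fun ω hω => Set.mem_iInter₂.2 fun ℓ hℓ =>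
      ⟨Sphar.isSymm_gammaHat T p N ℓ ω, hα ℓ, hτ ℓ, fun θ => ?_⟩))
  · -- `(pL)² = exp (2 log (pL)) ≤ exp (2 N / w²)`, while each tail is at most `4 exp (-3 N / w²)`.
    have hu : Real.log ((p : ℝ) * L) ≤ N * (w ^ 2)⁻¹ := by
      rw [← div_eq_mul_inv, le_div_iff₀ (by positivity)]; linarith
    have hv : 3 * (N * (w ^ 2)⁻¹) ≤ 3 * N / (1024 * p ^ 2) := by
      rw [← div_eq_mul_inv, ← mul_div_assoc]
      exact div_le_div_of_nonneg_left (by positivity) (by positivity) hw2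
    have hprod : ((p : ℝ) * L) ^ 2 * Real.exp (-(3 * N / (1024 * p ^ 2)))
        ≤ Real.exp (-1 * N * (w ^ 2)⁻¹) := by
      have e : ((p : ℝ) * L) ^ 2 = Real.exp (2 * Real.log ((p : ℝ) * L)) := by
        rw [two_mul, Real.exp_add, Real.exp_log (by linarith), pow_two]
      rw [e, ← Real.exp_add]
      exact Real.exp_le_exp.2 (by linarith)
    linarith
  · have h3 := hω ℓ (Finset.mem_range.1 hℓ) θ
    have h4 : 0 ≤ Sphar.tolerance k C w L N ℓ * (∑ i, |θ i|) ^ 2 :=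
      mul_nonneg (hτ ℓ) (by positivity)
    linarith
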